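/- **Lemma 6.1.** Let $(S_t)_{t\ge 0}$ be a subordinator started at $0$, without drift and without killing, with Lévy measure $\nu$ on $(0,\infty)$, $\int \min(1,y)\,\nu(dy)<\infty$. Let $\tilde\nu$ be the measure on $(0,1]$ that is the image of $\nu$ under $y\mapsto 1-e^{-y}$, and let $\tilde{\mathcal R}\subset[0,1]$ be the closed range of the process $\tilde S_t = 1-e^{-S_t}$. For $\rho\ge 0$ take a homogeneous Poisson point process of rate $\rho$ on $[0,1]$, independent of $(S_t)$, and put two of its atoms $u<v$ in the same block if and only if $\tilde{\mathcal R}\cap[u,v]=\emptyset$. Let $\widehat K_\rho$ be the number of blocks, and let $$p_j(\rho)=\mathbb P(\widehat K_\rho=j),\qquad f^{(m)}(\rho)=\mathbb E\big[\widehat K_\rho(\widehat K_\rho-1)\cdots(\widehat K_\rho-m+1)\big],\qquad j,m=0,1,2,\dots,\quad f^{(0)}=1.$$ Then $\widehat K_\rho$ is a random variable, all the $f^{(m)}(\rho)$ are finite, all the integrals below converge absolutely, and for every $\rho\ge 0$ the following hold. For $j=1,2,\dots$, $$\int_0^1 \big(p_j(\rho)-e^{-\rho x}p_j(\rho(1-x))\big)\,\tilde\nu(dx)=\int_0^1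 (1-e^{-\rho x})\,p_{j-1}(\rho(1-x))\,\tilde\nu(dx),$$ and for $m=1,2,\dots$, $$\int_0^1 \big(f^{(m)}(\rho)-f^{(m)}(\rho(1-x))\big)\,\tilde\nu(dx)=m\int_0^1 (1-e^{-\rho x})\,f^{(m-1)}(\rho(1-x))\,\tilde\nu(dx).$$ -/

import Mathlib

open MeasureTheory ProbabilityTheory Set
open scoped NNReal ENNReal

noncomputable section

namespace PoissonizedComposition

variable {Ω : Type*} [MeasurableSpace Ω]

/-- A Lévy measure of a subordinator that is never killed: a measure carried by `(0, ∞)` with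
`∫ min(1, y) ν(dy) < ∞`. -/
structure IsLevyMeasure (ν : Measure ℝ) : Prop where
  nonpos_null : ν (Iic 0) = 0
  lintegral_lt_top : ∫⁻ y, ENNReal.ofReal (min 1 y) ∂ν < ∞

/-- The Laplace exponent `Φ(s) = ∫ (1 - e^{-sy}) ν(dy)` of a driftless subordinator. -/
def laplaceExponent (ν : Measure ℝ) (s : ℝ) : ℝ :=
  ∫ y, (1 - Real.exp (-s * y)) ∂ν

/-- `S` is a subordinator with Lévy measure `ν`, without drift and without killing: it starts
at `0`, has nondecreasing right-continuous paths and stationary independent increments, and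
`E e^{-s S_t} = e^{-t Φ(s)}`. -/
structure IsDriftlessSubordinator (S : ℝ≥0 → Ω → ℝ) (ν : Measure ℝ) (P : Measure Ω) : Prop where
  measurable : ∀ t, Measurable (S t)
  zero : ∀ᵐ ω ∂P, S 0 ω = 0
  monotone : ∀ᵐ ω ∂P, Monotone fun t => S t ω
  rightContinuous : ∀ᵐ ω ∂P, ∀ t, ContinuousWithinAt (fun u => S u ω) (Ici t) t
  indepIncrements : HasIndepIncrements S P
  stationaryIncrements : ∀ s t, IdentDistrib (fun ω => S (s + t) ω - S s ω) (S t) P P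
  laplace : ∀ (t : ℝ≥0) (s : ℝ), 0 ≤ s →
    ∫ ω, Real.exp (-s * S t ω) ∂P = Real.exp (-(t : ℝ) * laplaceExponent ν s)

/-- The measure `ν̃` on `(0, 1]`: the image of `ν` under `y ↦ 1 - e^{-y}`. -/
def expImage (ν : Measure ℝ) : Measure ℝ :=
  ν.map fun y => 1 - Real.exp (-y)

/-- The closed range of the multiplicative subordinator `1 - exp (-S_t)`. -/
def closedRange (S : ℝ≥0 → Ω → ℝ) (ω : Ω) : Set ℝ :=
  closure (range fun t => 1 - Real.exp (-S t ω))

/-- The random set `η` is (the set of atoms of) a homogeneous Poisson process of rate `ρ` on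
`[0, 1]`: the number of its points in a Borel set `A` is Poisson with mean `ρ |A ∩ [0, 1]|`, and
the numbers of points in disjoint Borel sets are independent. In particular `η` is almost surely
a finite subset of `[0, 1]`. -/
structure IsPoissonProcess (η : Ω → Set ℝ) (ρ : ℝ) (P : Measure Ω) : Prop where
  measurable : ∀ A, MeasurableSet A → Measurable fun ω => (η ω ∩ A).encard
  law : ∀ A, MeasurableSet A → P.map (fun ω => (η ω ∩ A).encard) =
    (poissonMeasure (ρ * volume.real (A ∩ Icc 0 1)).toNNReal).map ((↑) : ℕ → ℕ∞)
  indep : ∀ (n : ℕ) (A : Fin n → Set ℝ), (∀ i, MeasurableSet (A i)) →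
    Pairwise (Function.onFun Disjoint A) → iIndepFun (fun i ω => (η ω ∩ A i).encard) P

/-- The point process `η` is independent of the process `S`. -/
def IndepOfProcess (η : Ω → Set ℝ) (S : ℝ≥0 → Ω → ℝ) (P : Measure Ω) : Prop :=
  IndepFun (fun ω (A : {A : Set ℝ // MeasurableSet A}) => (η ω ∩ A.1).encard)
    (fun ω t => S t ω) P

/-- The block of the sample point `u` when `R` separates the sample `η`: the points `v` of `η`
such that `R` does not meet the closed interval between `u` and `v`, together with `u` itself. -/
def block (R η : Set ℝ) (u : ℝ) : Set ℝ :=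
  {v ∈ η | v = u ∨ R ∩ uIcc u v = ∅}

/-- The length of the composition: the number of blocks into which `R` separates `η`. -/
def numBlocks (R η : Set ℝ) : ℕ :=
  (block R η '' η).ncard

/-- The number `K̂` of blocks into which the closed range of `1 - exp (-S_t)` separates `η`. -/
def compositionLength (S : ℝ≥0 → Ω → ℝ) (η : Ω → Set ℝ) (ω : Ω) : ℕ :=
  numBlocks (closedRange S ω) (η ω)

/-- `p_j(ρ) = P(K̂_ρ = j)`, where `N ρ` is the sample of rate `ρ`. -/
def lengthProb (S : ℝ≥0 → Ω → ℝ) (N : ℝ → Ω → Set ℝ) (P : Measure Ω) (j : ℕ) (ρ : ℝ) : ℝ :=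
  P.real {ω | compositionLength S (N ρ) ω = j}

/-- `f^{(m)}(ρ) = E [K̂_ρ (K̂_ρ - 1) ⋯ (K̂_ρ - m + 1)]`, where `N ρ` is the sample of rate `ρ`. -/
def factorialMoment (S : ℝ≥0 → Ω → ℝ) (N : ℝ → Ω → Set ℝ) (P : Measure Ω) (m : ℕ) (ρ : ℝ) : ℝ :=
  ∫ ω, ((compositionLength S (N ρ) ω).descFactorial m : ℝ) ∂P

end PoissonizedComposition

end

noncomputable section

namespace PoissonizedComposition

open Filter Topology

section Combinatorics

lemma numBlocks_congr {R R' η : Set ℝ}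
    (h : ∀ u ∈ η, ∀ v ∈ η, u ≠ v → (R ∩ uIcc u v = ∅ ↔ R' ∩ uIcc u v = ∅)) :
    numBlocks R η = numBlocks R' η := by
  unfold numBlocks
  congr 1
  refine image_congr fun u hu => ?_
  ext v
  simp only [block, mem_sep_iff]
  refine and_congr_right fun hv => ?_
  by_cases huv : v = u
  · simp [huv]
  · simp [huv, h u hu v hv (Ne.symm huv)]

lemma numBlocks_le_ncard (R : Set ℝ) {η : Set ℝ} (hη : η.Finite) : numBlocks R η ≤ η.ncard :=
  ncard_image_le hη

lemma eventually_numBlocks_eq {ι : Type*} {l : Filter ι} {R : ι → Set ℝ} {R' η : Set ℝ}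
    (hη : η.Finite)
    (h : ∀ u ∈ η, ∀ v ∈ η, u ≠ v → ∀ᶠ k in l, (R k ∩ uIcc u v = ∅ ↔ R' ∩ uIcc u v = ∅)) :
    ∀ᶠ k in l, numBlocks (R k) η = numBlocks R' η := by
  have : ∀ᶠ k in l, ∀ u ∈ η, ∀ v ∈ η, u ≠ v → (R k ∩ uIcc u v = ∅ ↔ R' ∩ uIcc u v = ∅) := by
    refine (eventually_all_finite hη).2 fun u hu => (eventually_all_finite hη).2 fun v hv => ?_
    by_cases huv : u = v
    · simp [huv]
    · filter_upwards [h u hu v hv huv] with k hk _ using hk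
  filter_upwards [this] with k hk using numBlocks_congr hk

lemma eventually_numBlocks_eq_of_monotone {R : ℕ → Set ℝ} {R' η : Set ℝ} (hη : η.Finite)
    (hR : Monotone R) (hsub : ∀ k, R k ⊆ R') (hdense : R' ⊆ closure (⋃ k, R k))
    (hd : Disjoint η R') : ∀ᶠ k in atTop, numBlocks (R k) η = numBlocks R' η := by
  refine eventually_numBlocks_eq hη fun u hu v hv huv => ?_
  by_cases hE : R' ∩ uIcc u v = ∅
  · refine Eventually.of_forall fun k => iff_of_true ?_ hE
    exact subset_empty_iff.1 ((inter_subset_inter_left _ (hsub k)).trans hE.le)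
  · obtain ⟨r, hr, hruv⟩ := nonempty_iff_ne_empty.2 hE
    have hru : r ≠ u := fun h => disjoint_left.1 hd hu (h ▸ hr)
    have hrv : r ≠ v := fun h => disjoint_left.1 hd hv (h ▸ hr)
    have hmem : r ∈ Ioo (min u v) (max u v) := by
      rw [uIcc, mem_Icc] at hruv
      refine ⟨lt_of_le_of_ne hruv.1 ?_, lt_of_le_of_ne hruv.2 ?_⟩
      · rcases min_choice u v with h | h <;> rw [h]
        exacts [hru.symm, hrv.symm]
      · rcases max_choice u v with h | h <;> rw [h]
        exacts [hru, hrv]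
    obtain ⟨x, hx, hx'⟩ := mem_closure_iff.1 (hdense hr) _ isOpen_Ioo hmem
    obtain ⟨k, hk⟩ := mem_iUnion.1 hx'
    filter_upwards [eventually_ge_atTop k] with j hj
    refine iff_of_false (fun h => ?_) hE
    exact notMem_empty x (h ▸ ⟨hR hj hk, Ioo_subset_Icc_self hx⟩)

open Classical in
/-- The number of the cells `[b i, b (i + 1))`, `i ≤ M`, that contain a point of `η`. -/
def occupied (b : ℕ → ℝ) (M : ℕ) (η : Set ℝ) : ℕ :=
  ∑ i ∈ Finset.range (M + 1), if (η ∩ Ico (b i) (b (i + 1))).Nonempty then 1 else 0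

lemma occupied_le (b : ℕ → ℝ) (M : ℕ) (η : Set ℝ) : occupied b M η ≤ M + 1 := by
  classical
  calc occupied b M η ≤ ∑ i ∈ Finset.range (M + 1), 1 :=
        Finset.sum_le_sum fun i _ => by split_ifs <;> simp
    _ = M + 1 := by simp

lemma exists_mem_cell {b : ℕ → ℝ} {M : ℕ} {u : ℝ} (hu : u ∈ Ico (b 0) (b (M + 1))) :
    ∃ i ≤ M, u ∈ Ico (b i) (b (i + 1)) := by
  induction M with
  | zero => exact ⟨0, le_rfl, hu⟩
  | succ M ih =>
    by_cases h : u < b (M + 1)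
    · obtain ⟨i, hi, hi'⟩ := ih ⟨hu.1, h⟩
      exact ⟨i, by omega, hi'⟩
    · exact ⟨M + 1, le_rfl, not_lt.1 h, hu.2⟩

lemma cell_unique {b : ℕ → ℝ} (hb : Monotone b) {u : ℝ} {i j : ℕ}
    (hi : u ∈ Ico (b i) (b (i + 1))) (hj : u ∈ Ico (b j) (b (j + 1))) : i = j := by
  by_contra h
  rcases lt_or_gt_of_ne h with h | h
  · exact absurd (hj.1.trans_lt hi.2) (not_lt.2 (hb h))
  · exact absurd (hi.1.trans_lt hj.2) (not_lt.2 (hb h))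

lemma block_grid {b : ℕ → ℝ} {M : ℕ} {η : Set ℝ} (hb : Monotone b)
    (hη : η ⊆ Ico (b 0) (b (M + 1))) (hd : ∀ u ∈ η, ∀ i ≤ M, u ≠ b i) {u : ℝ} (hu : u ∈ η)
    {i : ℕ} (hi : i ≤ M) (hui : u ∈ Ico (b i) (b (i + 1))) :
    block (b '' Iic M) η u = η ∩ Ico (b i) (b (i + 1)) := by
  ext v
  simp only [block, mem_sep_iff, mem_inter_iff]
  refine and_congr_right fun hv => ⟨?_, fun hvi => Or.inr ?_⟩
  · rintro (rfl | h)
    · exact hui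
    · obtain ⟨j, hj, hvj⟩ := exists_mem_cell (hη hv)
      rcases lt_trichotomy i j with hij | rfl | hij
      · exfalso
        refine notMem_empty (b j) (h ▸ ⟨mem_image_of_mem _ hj, ?_⟩)
        exact mem_uIcc.2 (Or.inl ⟨hui.2.le.trans (hb hij), hvj.1⟩)
      · exact hvj
      · exfalso
        refine notMem_empty (b i) (h ▸ ⟨mem_image_of_mem _ hi, ?_⟩)
        exact mem_uIcc.2 (Or.inr ⟨hvj.2.le.trans (hb hij), hui.1⟩)
  · refine eq_empty_iff_forall_notMem.2 ?_
    rintro _ ⟨⟨j, hj, rfl⟩, hx⟩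
    have hju := hd u hu j hj
    have hjv := hd v hv j hj
    rcases le_or_gt j i with hji | hji
    · have h1 := lt_of_le_of_ne ((hb hji).trans hui.1) hju.symm
      have h2 := lt_of_le_of_ne ((hb hji).trans hvi.1) hjv.symm
      rcases mem_uIcc.1 hx with h | h
      · exact absurd h.1 (not_le.2 h1)
      · exact absurd h.1 (not_le.2 h2)
    · have h1 := hui.2.trans_le (hb hji)
      have h2 := hvi.2.trans_le (hb hji)
      rcases mem_uIcc.1 hx with h | h
      · exact absurd h.2 (not_le.2 h2)
      · exact absurd h.2 (not_le.2 h1)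

lemma numBlocks_grid {b : ℕ → ℝ} {M : ℕ} {η : Set ℝ} (hb : Monotone b)
    (hη : η ⊆ Ico (b 0) (b (M + 1))) (hd : ∀ u ∈ η, ∀ i ≤ M, u ≠ b i) :
    numBlocks (b '' Iic M) η = occupied b M η := by
  classical
  set F : Finset ℕ := (Finset.range (M + 1)).filter fun i => (η ∩ Ico (b i) (b (i + 1))).Nonempty
    with hF
  have himg : block (b '' Iic M) η '' η = (fun i => η ∩ Ico (b i) (b (i + 1))) '' (F : Set ℕ) := by
    ext s
    constructor
    · rintro ⟨u, hu, rfl⟩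
      obtain ⟨i, hi, hui⟩ := exists_mem_cell (hη hu)
      refine ⟨i, ?_, (block_grid hb hη hd hu hi hui).symm⟩
      simp only [hF, Finset.coe_filter, Finset.mem_range, mem_ofPred_eq]
      exact ⟨by omega, u, hu, hui⟩
    · rintro ⟨i, hi, rfl⟩
      simp only [hF, Finset.coe_filter, Finset.mem_range, mem_ofPred_eq] at hi
      obtain ⟨hi, u, hu, hui⟩ := hi
      exact ⟨u, hu, block_grid hb hη hd hu (by omega) hui⟩
  have hinj : InjOn (fun i => η ∩ Ico (b i) (b (i + 1))) (F : Set ℕ) := by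
    intro i hi j hj hij
    simp only [hF, Finset.coe_filter, Finset.mem_range, mem_ofPred_eq] at hi
    obtain ⟨hi, u, hu, hui⟩ := hi
    have : u ∈ η ∩ Ico (b j) (b (j + 1)) := by
      have h : u ∈ η ∩ Ico (b i) (b (i + 1)) := ⟨hu, hui⟩
      have hij' : η ∩ Ico (b i) (b (i + 1)) = η ∩ Ico (b j) (b (j + 1)) := hij
      rwa [hij'] at h
    exact cell_unique hb hui this.2
  rw [numBlocks, himg, hinj.ncard_image, ncard_coe_finset, hF, Finset.card_filter,
    occupied]

end Combinatorics

section BernoulliSums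

/-- The expectation of `h (B 0 + ⋯ + B (n - 1))` for independent Bernoulli variables `B i` of
parameters `q i`. -/
def bernoulliMean : ℕ → (ℕ → ℝ) → (ℕ → ℝ) → ℝ
  | 0, _, h => h 0
  | n + 1, q, h => (1 - q 0) * bernoulliMean n (fun i => q (i + 1)) h +
      q 0 * bernoulliMean n (fun i => q (i + 1)) (fun k => h (k + 1))

lemma bernoulliMean_succ_last (n : ℕ) (q h : ℕ → ℝ) :
    bernoulliMean (n + 1) q h = (1 - q n) * bernoulliMean n q h +
      q n * bernoulliMean n q (fun k => h (k + 1)) := by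
  induction n generalizing q h with
  | zero => simp [bernoulliMean]
  | succ n ih =>
    rw [bernoulliMean, ih, ih]
    simp only [bernoulliMean]
    ring

lemma bernoulliMean_congr {n : ℕ} {q q' : ℕ → ℝ} (hq : ∀ i < n, q i = q' i) (h : ℕ → ℝ) :
    bernoulliMean n q h = bernoulliMean n q' h := by
  induction n generalizing h with
  | zero => rfl
  | succ n ih =>
    rw [bernoulliMean_succ_last, bernoulliMean_succ_last, hq n (by omega),
      ih fun i hi => hq i (by omega), ih fun i hi => hq i (by omega)]

lemma continuous_bernoulliMean (n : ℕ) (h : ℕ → ℝ) :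
    Continuous fun q : ℕ → ℝ => bernoulliMean n q h := by
  induction n generalizing h with
  | zero => exact continuous_const
  | succ n ih =>
    simp_rw [bernoulliMean_succ_last]
    have h1 := ih h
    have h2 := ih fun k => h (k + 1)
    fun_prop

/-- The functions `h` on `ℕ` with `|h k| ≤ C 2 ^ k`. -/
def ExpBound (C : ℝ) (h : ℕ → ℝ) : Prop := ∀ k, |h k| ≤ C * 2 ^ k

lemma ExpBound.shift {C : ℝ} {h : ℕ → ℝ} (hh : ExpBound C h) :
    ExpBound (2 * C) fun k => h (k + 1) := fun k => by
  have := hh (k + 1)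
  rw [pow_succ] at this
  linarith

lemma ExpBound.nonneg {C : ℝ} {h : ℕ → ℝ} (hh : ExpBound C h) : 0 ≤ C := by
  simpa using (abs_nonneg _).trans (hh 0)

lemma abs_mix_le {q a b A B : ℝ} (h0 : 0 ≤ q) (h1 : q ≤ 1) (ha : |a| ≤ A) (hb : |b| ≤ B) :
    |(1 - q) * a + q * b| ≤ (1 - q) * A + q * B := by
  refine (abs_add_le _ _).trans ?_
  rw [abs_mul, abs_mul, abs_of_nonneg h0, abs_of_nonneg (sub_nonneg.2 h1)]
  have := sub_nonneg.2 h1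
  gcongr

lemma abs_bernoulliMean_le {n : ℕ} {q h : ℕ → ℝ} {C : ℝ} (h0 : ∀ i, 0 ≤ q i) (h1 : ∀ i, q i ≤ 1)
    (hh : ExpBound C h) : |bernoulliMean n q h| ≤ C * 2 ^ n := by
  induction n generalizing C h with
  | zero => exact hh 0
  | succ n ih =>
    rw [bernoulliMean_succ_last]
    refine (abs_mix_le (h0 n) (h1 n) (ih hh) (ih hh.shift)).trans ?_
    have := hh.nonneg
    have h2 : (0 : ℝ) ≤ C * 2 ^ n := by positivity
    rw [pow_succ]
    nlinarith [h1 n, h0 n]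

end BernoulliSums

section GapSums

/-- The expectation of `h` of the number of occupied cells among the `M + 1` cells into which the
points `1 - exp (-(X 0 + ⋯ + X (i - 1)))`, `1 ≤ i ≤ M`, divide `[0, 1]`, for a Poisson sample
of rate `ρ`. -/
def gapMean : ℕ → (ℕ → ℝ≥0) → (ℕ → ℝ) → ℝ → ℝ
  | 0, _, h, ρ => Real.exp (-ρ) * h 0 + (1 - Real.exp (-ρ)) * h 1
  | M + 1, X, h, ρ =>
      Real.exp (-(ρ * (1 - Real.exp (-(X 0 : ℝ))))) *
        gapMean M (fun i => X (i + 1)) h (ρ * Real.exp (-(X 0 : ℝ))) +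
      (1 - Real.exp (-(ρ * (1 - Real.exp (-(X 0 : ℝ)))))) *
        gapMean M (fun i => X (i + 1)) (fun k => h (k + 1)) (ρ * Real.exp (-(X 0 : ℝ)))

lemma continuous_gapMean (M : ℕ) (h : ℕ → ℝ) :
    Continuous fun p : ℝ × (ℕ → ℝ≥0) => gapMean M p.2 h p.1 := by
  induction M generalizing h with
  | zero => simp only [gapMean]; fun_prop
  | succ M ih =>
    simp only [gapMean]
    have key : Continuous fun p : ℝ × (ℕ → ℝ≥0) =>
        (p.1 * Real.exp (-(p.2 0 : ℝ)), fun i => p.2 (i + 1)) := by fun_prop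
    have h1 := (ih h).comp key
    have h2 := (ih fun k => h (k + 1)).comp key
    simp only [Function.comp_def] at h1 h2
    fun_prop

lemma exp_mul_two_sub_le {ρ : ℝ} : Real.exp (-ρ) + (1 - Real.exp (-ρ)) * 2 ≤ Real.exp ρ := by
  have h1 : Real.exp (-ρ) * Real.exp ρ = 1 := by rw [← Real.exp_add]; simp
  nlinarith [sq_nonneg (Real.exp (-ρ) - 1), Real.exp_pos ρ, Real.exp_pos (-ρ)]

lemma exp_neg_mul_mem {ρ x : ℝ} (hρ : 0 ≤ ρ) (hx : 0 ≤ x) :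
    0 ≤ 1 - Real.exp (-(ρ * x)) ∧ 1 - Real.exp (-(ρ * x)) ≤ 1 := by
  refine ⟨sub_nonneg.2 (Real.exp_le_one_iff.2 (by nlinarith [mul_nonneg hρ hx])), ?_⟩
  linarith [Real.exp_pos (-(ρ * x))]

lemma one_sub_exp_neg_mem (y : ℝ≥0) : 0 ≤ 1 - Real.exp (-(y : ℝ)) ∧ 1 - Real.exp (-(y : ℝ)) ≤ 1 := by
  simpa using exp_neg_mul_mem (x := (y : ℝ)) zero_le_one y.2

lemma abs_gapMean_le {M : ℕ} {X : ℕ → ℝ≥0} {h : ℕ → ℝ} {C ρ : ℝ} (hρ : 0 ≤ ρ)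
    (hh : ExpBound C h) : |gapMean M X h ρ| ≤ C * Real.exp ρ := by
  induction M generalizing X h C ρ with
  | zero =>
    have hq := exp_neg_mul_mem hρ zero_le_one
    rw [mul_one] at hq
    have := abs_mix_le hq.1 hq.2 (hh 0) (hh 1)
    rw [gapMean]
    rw [sub_sub_cancel] at this
    refine this.trans ?_
    have h2 := mul_le_mul_of_nonneg_left (exp_mul_two_sub_le (ρ := ρ)) hh.nonneg
    linarith
  | succ M ih =>
    rw [gapMean]
    set x := 1 - Real.exp (-(X 0 : ℝ)) with hx
    have hx0 := one_sub_exp_neg_mem (X 0)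
    have he : Real.exp (-(X 0 : ℝ)) = 1 - x := by rw [hx]; ring
    rw [he]
    have hρ' : 0 ≤ ρ * (1 - x) := mul_nonneg hρ (sub_nonneg.2 hx0.2)
    have hq := exp_neg_mul_mem hρ hx0.1
    have := abs_mix_le hq.1 hq.2 (ih hρ' (X := fun i => X (i + 1)) hh)
      (ih hρ' (X := fun i => X (i + 1)) hh.shift)
    rw [sub_sub_cancel] at this
    refine this.trans ?_
    have h2 := mul_le_mul_of_nonneg_left (exp_mul_two_sub_le (ρ := ρ * x))
      (mul_nonneg hh.nonneg (Real.exp_pos (ρ * (1 - x))).le)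
    have h3 : Real.exp ρ = Real.exp (ρ * (1 - x)) * Real.exp (ρ * x) := by
      rw [← Real.exp_add]; ring_nf
    rw [h3]
    linarith

lemma abs_exp_neg_sub_le {a b : ℝ} (ha : 0 ≤ a) (hab : a ≤ b) :
    |Real.exp (-a) - Real.exp (-b)| ≤ b - a := by
  rw [abs_of_nonneg (sub_nonneg.2 (Real.exp_le_exp.2 (by linarith)))]
  have h1 : Real.exp (-b) = Real.exp (-a) * Real.exp (-(b - a)) := by
    rw [← Real.exp_add]; ring_nf
  have h2 := Real.add_one_le_exp (-(b - a))
  have h3 : Real.exp (-a) ≤ 1 := Real.exp_le_one_iff.2 (by linarith)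
  rw [h1]
  nlinarith [Real.exp_pos (-a)]

lemma abs_gapMean_sub_le {M : ℕ} {X : ℕ → ℝ≥0} {h : ℕ → ℝ} {C ρ ρ' : ℝ} (hρ : 0 ≤ ρ)
    (hρρ' : ρ ≤ ρ') (hh : ExpBound C h) :
    |gapMean M X h ρ - gapMean M X h ρ'| ≤ 3 * C * Real.exp ρ' * (ρ' - ρ) := by
  have hC := hh.nonneg
  induction M generalizing X h C ρ ρ' with
  | zero =>
    have h1 : |h 0 - h 1| ≤ 3 * C := by
      have h0 := hh 0
      have h1 := hh 1
      rw [abs_le] at *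
      constructor <;> linarith
    have h2 : gapMean 0 X h ρ - gapMean 0 X h ρ' =
        (Real.exp (-ρ) - Real.exp (-ρ')) * (h 0 - h 1) := by simp only [gapMean]; ring
    rw [h2, abs_mul]
    have h3 := abs_exp_neg_sub_le hρ hρρ'
    have h4 : 1 ≤ Real.exp ρ' := Real.one_le_exp (hρ.trans hρρ')
    have h5 : 0 ≤ ρ' - ρ := sub_nonneg.2 hρρ'
    calc |Real.exp (-ρ) - Real.exp (-ρ')| * |h 0 - h 1| ≤ (ρ' - ρ) * (3 * C) := by gcongr
      _ ≤ 3 * C * Real.exp ρ' * (ρ' - ρ) := by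
        have : 0 ≤ C * (ρ' - ρ) := mul_nonneg hC h5
        nlinarith
  | succ M ih =>
    simp only [gapMean]
    set x := 1 - Real.exp (-(X 0 : ℝ)) with hx
    have hx0 := one_sub_exp_neg_mem (X 0)
    rw [← hx] at hx0
    have he : Real.exp (-(X 0 : ℝ)) = 1 - x := by rw [hx]; ring
    rw [he]
    set Y := fun i => X (i + 1)
    set h' := fun k => h (k + 1)
    have hx1 : 0 ≤ 1 - x := sub_nonneg.2 hx0.2
    have hρ' : 0 ≤ ρ' := hρ.trans hρρ'
    have hd : 0 ≤ ρ' - ρ := sub_nonneg.2 hρρ'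
    have hle : ρ * (1 - x) ≤ ρ' * (1 - x) := by gcongr
    have hA := ih (X := Y) (mul_nonneg hρ hx1) hle hh hC
    have hB := ih (X := Y) (mul_nonneg hρ hx1) hle hh.shift (by positivity)
    have hA' := abs_gapMean_le (M := M) (X := Y) (mul_nonneg hρ' hx1) hh
    have hB' := abs_gapMean_le (M := M) (X := Y) (mul_nonneg hρ' hx1) hh.shift
    set E := Real.exp (ρ' * (1 - x)) with hE
    have hEpos : 0 < E := Real.exp_pos _
    have hq := exp_neg_mul_mem hρ hx0.1
    set q := 1 - Real.exp (-(ρ * x)) with hqdef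
    set q' := 1 - Real.exp (-(ρ' * x)) with hqdef'
    have hqq : |q - q'| ≤ (ρ' - ρ) * x := by
      have := abs_exp_neg_sub_le (mul_nonneg hρ hx0.1) (mul_le_mul_of_nonneg_right hρρ' hx0.1)
      rw [hqdef, hqdef', show (1 - Real.exp (-(ρ * x)) - (1 - Real.exp (-(ρ' * x)))) =
        -(Real.exp (-(ρ * x)) - Real.exp (-(ρ' * x))) by ring, abs_neg]
      linarith
    have hqle : q ≤ q' := by
      have : Real.exp (-(ρ' * x)) ≤ Real.exp (-(ρ * x)) :=
        Real.exp_le_exp.2 (neg_le_neg (mul_le_mul_of_nonneg_right hρρ' hx0.1))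
      linarith
    have e1 : Real.exp (-(ρ * x)) = 1 - q := by rw [hqdef]; ring
    have e2 : Real.exp (-(ρ' * x)) = 1 - q' := by rw [hqdef']; ring
    have hmix := abs_mix_le hq.1 hq.2 hA hB
    have hsplit : Real.exp (-(ρ * x)) * gapMean M Y h (ρ * (1 - x)) +
        q * gapMean M Y h' (ρ * (1 - x)) -
        (Real.exp (-(ρ' * x)) * gapMean M Y h (ρ' * (1 - x)) +
        q' * gapMean M Y h' (ρ' * (1 - x))) =
        ((1 - q) * (gapMean M Y h (ρ * (1 - x)) - gapMean M Y h (ρ' * (1 - x))) +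
        q * (gapMean M Y h' (ρ * (1 - x)) - gapMean M Y h' (ρ' * (1 - x)))) +
        (q - q') * (gapMean M Y h' (ρ' * (1 - x)) - gapMean M Y h (ρ' * (1 - x))) := by
      rw [e1, e2]; ring
    rw [hsplit]
    refine (abs_add_le _ _).trans ?_
    rw [abs_mul]
    have hdiff : |gapMean M Y h' (ρ' * (1 - x)) - gapMean M Y h (ρ' * (1 - x))| ≤ 3 * C * E := by
      rw [abs_le] at *
      constructor <;> linarith
    have hlast : |q - q'| * |gapMean M Y h' (ρ' * (1 - x)) - gapMean M Y h (ρ' * (1 - x))| ≤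
        ((ρ' - ρ) * x) * (3 * C * E) := by
      have := mul_nonneg hd hx0.1
      gcongr
    refine (add_le_add hmix hlast).trans ?_
    have hexp : Real.exp ρ' = E * Real.exp (ρ' * x) := by
      rw [hE, ← Real.exp_add]; ring_nf
    have h2 : 1 + q ≤ Real.exp (ρ' * x) := by
      have := exp_mul_two_sub_le (ρ := ρ' * x)
      rw [e2] at this
      linarith
    have h3 : 1 ≤ Real.exp (ρ' * x) := Real.one_le_exp (mul_nonneg hρ' hx0.1)
    have hK : 0 ≤ 3 * C * E * (ρ' - ρ) := by positivity
    have hL1 := mul_le_mul_of_nonneg_left h2 (mul_nonneg hK hx1)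
    have hL2 := mul_le_mul_of_nonneg_left h3 (mul_nonneg hK hx0.1)
    rw [hexp]
    linarith

/-- The probability that the `i`-th of the cells of `gapMean M X` is occupied. -/
def gapProb (M : ℕ) (X : ℕ → ℝ≥0) (ρ : ℝ) (i : ℕ) : ℝ :=
  if i < M then
    1 - Real.exp (-(ρ * (Real.exp (-∑ j ∈ Finset.range i, (X j : ℝ)) -
      Real.exp (-∑ j ∈ Finset.range (i + 1), (X j : ℝ)))))
  else 1 - Real.exp (-(ρ * Real.exp (-∑ j ∈ Finset.range M, (X j : ℝ))))

lemma gapMean_eq_bernoulliMean (M : ℕ) (X : ℕ → ℝ≥0) (h : ℕ → ℝ) (ρ : ℝ) :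
    gapMean M X h ρ = bernoulliMean (M + 1) (gapProb M X ρ) h := by
  induction M generalizing X h ρ with
  | zero => simp [gapMean, bernoulliMean, gapProb]
  | succ M ih =>
    have key : ∀ i, gapProb (M + 1) X ρ (i + 1) =
        gapProb M (fun i => X (i + 1)) (ρ * Real.exp (-(X 0 : ℝ))) i := by
      intro i
      simp only [gapProb, Finset.sum_range_succ' _ (i + 1), Finset.sum_range_succ' _ i,
        Finset.sum_range_succ' _ M, neg_add, Real.exp_add, add_lt_add_iff_right]
      split_ifs <;> ring_nf
    have h0 : gapProb (M + 1) X ρ 0 = 1 - Real.exp (-(ρ * (1 - Real.exp (-(X 0 : ℝ))))) := by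
      simp [gapProb]
    rw [bernoulliMean, gapMean, ih, ih, funext key, h0, sub_sub_cancel]

end GapSums

section PoissonProcess

variable {Ω : Type*} [MeasurableSpace Ω] {P : Measure Ω} {η : Ω → Set ℝ} {ρ : ℝ}

/-- The counts of the points of `η` in the Borel sets. -/
def counts (η : Ω → Set ℝ) (ω : Ω) (A : {A : Set ℝ // MeasurableSet A}) : ℕ∞ :=
  (η ω ∩ A.1).encard

lemma IsPoissonProcess.measurable_counts (hη : IsPoissonProcess η ρ P) : Measurable (counts η) :=
  measurable_pi_lambda _ fun A => hη.measurable A.1 A.2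

lemma IsPoissonProcess.measure_encard_eq (hη : IsPoissonProcess η ρ P) {A : Set ℝ}
    (hA : MeasurableSet A) (s : Set ℕ∞) :
    P {ω | (η ω ∩ A).encard ∈ s} =
      poissonMeasure (ρ * volume.real (A ∩ Icc 0 1)).toNNReal {n : ℕ | (n : ℕ∞) ∈ s} := by
  have h := congrArg (fun μ : Measure ℕ∞ => μ s) (hη.law A hA)
  simp only [Measure.map_apply (hη.measurable A hA) (MeasurableSet.of_discrete (s := s)),
    Measure.map_apply (Measurable.of_discrete (f := ((↑) : ℕ → ℕ∞)))
    (MeasurableSet.of_discrete (s := s))] at h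
  exact h

lemma IsPoissonProcess.measurableSet_nonempty (hη : IsPoissonProcess η ρ P) {A : Set ℝ}
    (hA : MeasurableSet A) : MeasurableSet {ω | (η ω ∩ A).Nonempty} := by
  have : {ω | (η ω ∩ A).Nonempty} = (fun ω => (η ω ∩ A).encard) ⁻¹' {0}ᶜ := by
    ext ω; simp [nonempty_iff_ne_empty]
  rw [this]
  exact hη.measurable A hA MeasurableSet.of_discrete

lemma IsPoissonProcess.measureReal_nonempty (hη : IsPoissonProcess η ρ P) (hρ : 0 ≤ ρ) {A : Set ℝ}
    (hA : MeasurableSet A) : P.real {ω | (η ω ∩ A).Nonempty} =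
      1 - Real.exp (-(ρ * volume.real (A ∩ Icc 0 1))) := by
  have h0 := hη.measure_encard_eq hA {0}ᶜ
  have h1 : {ω | (η ω ∩ A).encard ∈ ({0} : Set ℕ∞)ᶜ} = {ω | (η ω ∩ A).Nonempty} := by
    ext ω; simp [nonempty_iff_ne_empty]
  have h2 : {n : ℕ | (n : ℕ∞) ∈ ({0} : Set ℕ∞)ᶜ} = {0}ᶜ := by ext n; simp
  rw [h1, h2] at h0
  rw [measureReal_def, h0, ← measureReal_def, probReal_compl_eq_one_sub (by measurability),
    poissonMeasure_real_singleton]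
  simp [Real.coe_toNNReal _ (mul_nonneg hρ measureReal_nonneg)]

lemma IsPoissonProcess.measureReal_nonempty_le (hη : IsPoissonProcess η ρ P) (hρ : 0 ≤ ρ)
    {A : Set ℝ} (hA : MeasurableSet A) :
    P.real {ω | (η ω ∩ A).Nonempty} ≤ ρ * volume.real (A ∩ Icc 0 1) := by
  rw [hη.measureReal_nonempty hρ hA]
  linarith [Real.add_one_le_exp (-(ρ * volume.real (A ∩ Icc 0 1)))]

lemma IsPoissonProcess.ae_disjoint [IsProbabilityMeasure P] (hη : IsPoissonProcess η ρ P)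
    (hρ : 0 ≤ ρ) {A : Set ℝ}
    (hA : MeasurableSet A) (h0 : volume (A ∩ Icc 0 1) = 0) : ∀ᵐ ω ∂P, ∀ u ∈ η ω, u ∉ A := by
  have h1 := hη.measureReal_nonempty hρ hA
  rw [measureReal_def volume, h0] at h1
  have h2 : P {ω | (η ω ∩ A).Nonempty} = 0 := by
    rw [← measureReal_eq_zero_iff]; simpa using h1
  have h3 : ∀ᵐ ω ∂P, ¬ (η ω ∩ A).Nonempty := by rw [ae_iff]; simpa using h2
  filter_upwards [h3] with ω hω u hu huA using hω ⟨u, hu, huA⟩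

lemma IsPoissonProcess.ae_mem_Icc [IsProbabilityMeasure P] (hη : IsPoissonProcess η ρ P)
    (hρ : 0 ≤ ρ) : ∀ᵐ ω ∂P, ∀ u ∈ η ω, u ∈ Icc (0 : ℝ) 1 := by
  filter_upwards [hη.ae_disjoint hρ (measurableSet_Icc (a := (0 : ℝ)) (b := 1)).compl (by simp)]
    with ω hω u hu using by simpa using hω u hu

lemma IsPoissonProcess.ae_finite (hη : IsPoissonProcess η ρ P) : ∀ᵐ ω ∂P, (η ω).Finite := by
  have h := hη.measure_encard_eq MeasurableSet.univ {⊤}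
  rw [ae_iff]
  simpa [← encard_lt_top_iff] using h

lemma integrable_two_pow_poissonMeasure (r : ℝ≥0) :
    Integrable (fun n : ℕ => (2 : ℝ) ^ n) (poissonMeasure r) := by
  rw [integrable_poissonMeasure_iff]
  have := (Real.summable_pow_div_factorial (2 * r)).mul_left (Real.exp (-r))
  refine this.congr fun n => ?_
  rw [Real.norm_of_nonneg (by positivity), mul_pow]
  ring

lemma IsPoissonProcess.integrable_two_pow (hη : IsPoissonProcess η ρ P) :
    Integrable (fun ω => (2 : ℝ) ^ (η ω).ncard) P := by
  have h1 : Integrable (fun n : ℕ∞ => (2 : ℝ) ^ n.toNat)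
      (P.map fun ω => (η ω ∩ univ).encard) := by
    rw [hη.law _ MeasurableSet.univ, integrable_map_measure .of_discrete .of_discrete]
    exact integrable_two_pow_poissonMeasure _
  have h2 := h1.comp_measurable (hη.measurable _ MeasurableSet.univ)
  simpa [Function.comp_def, ncard_def] using h2

lemma iIndepFun_nat_of_fin {β : Type*} [MeasurableSpace β] {f : ℕ → Ω → β} [IsProbabilityMeasure P]
    (h : ∀ n, iIndepFun (fun i : Fin n => f i) P) : iIndepFun f P := by
  refine iIndepFun_iff_finset.2 fun s => ?_
  let g (x : s) : Fin (s.sup id + 1) := ⟨x.1, Nat.lt_add_one_of_le (Finset.le_sup (f := id) x.2)⟩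
  refine iIndepFun.precomp (g := g) ?_ (h (s.sup id + 1))
  intro x y hxy
  exact Subtype.ext (congrArg Fin.val hxy)

/-- The probability that a Poisson sample of rate `ρ` has a point in `[b i, b (i + 1))`. -/
def cellProb (ρ : ℝ) (b : ℕ → ℝ) (i : ℕ) : ℝ :=
  1 - Real.exp (-(ρ * volume.real (Ico (b i) (b (i + 1)) ∩ Icc 0 1)))

/-- The number of the first `M + 1` cells of `b` with a positive count. -/
def countOccupied (b : ℕ → ℝ) (M : ℕ) (c : {A : Set ℝ // MeasurableSet A} → ℕ∞) : ℕ :=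
  ∑ i ∈ Finset.range (M + 1),
    if c ⟨Ico (b i) (b (i + 1)), measurableSet_Ico⟩ = 0 then 0 else 1

lemma countOccupied_counts {Ω : Type*} {η : Ω → Set ℝ} (b : ℕ → ℝ) (M : ℕ) (ω : Ω) :
    countOccupied b M (counts η ω) = occupied b M (η ω) := by
  refine Finset.sum_congr rfl fun i _ => ?_
  simp only [counts, encard_eq_zero, nonempty_iff_ne_empty]
  split_ifs <;> simp_all

lemma measurable_countOccupied (b : ℕ → ℝ) (M : ℕ) : Measurable (countOccupied b M) := by
  refine Finset.measurable_fun_sum _ fun i _ => ?_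
  exact (Measurable.of_discrete (f := fun c : ℕ∞ => if c = 0 then 0 else 1)).comp
    (measurable_pi_apply _)

lemma abs_le_of_expBound {h : ℕ → ℝ} {C : ℝ} (hh : ExpBound C h) {k n : ℕ} (hk : k ≤ n) :
    |h k| ≤ C * 2 ^ n :=
  (hh k).trans (mul_le_mul_of_nonneg_left (pow_le_pow_right₀ one_le_two hk) hh.nonneg)

open Classical in
lemma IsPoissonProcess.integral_occupied [IsProbabilityMeasure P] (hη : IsPoissonProcess η ρ P)
    (hρ : 0 ≤ ρ) {b : ℕ → ℝ} (hb : Monotone b) (M : ℕ) {h : ℕ → ℝ} {C : ℝ} (hh : ExpBound C h) :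
    ∫ ω, h (occupied b M (η ω)) ∂P = bernoulliMean (M + 1) (cellProb ρ b) h := by
  set B : ℕ → Ω → ℕ := fun i ω => if (η ω ∩ Ico (b i) (b (i + 1))).Nonempty then 1 else 0 with hB
  have hBm : ∀ i, Measurable (B i) := fun i =>
    Measurable.ite (hη.measurableSet_nonempty measurableSet_Ico) measurable_const measurable_const
  have hBi : iIndepFun B P := by
    refine iIndepFun_nat_of_fin fun n => ?_
    have h1 := hη.indep n (fun i => Ico (b i) (b (i + 1))) (fun i => measurableSet_Ico)
      (fun i j hij => disjoint_left.2 fun u hi hj => hij (Fin.ext (cell_unique hb hi hj)))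
    have h2 := h1.comp (fun _ c => if c = 0 then 0 else 1) fun _ => Measurable.of_discrete
    convert! h2 using 2 with i
    ext ω
    simp only [hB, Function.comp_apply, encard_eq_zero, nonempty_iff_ne_empty]
    split_ifs <;> simp_all
  have hBreal : ∀ i, ∫ ω, (B i ω : ℝ) ∂P = cellProb ρ b i := fun i => by
    have : (fun ω => (B i ω : ℝ)) =
        {ω | (η ω ∩ Ico (b i) (b (i + 1))).Nonempty}.indicator 1 := by
      ext ω; simp [hB, indicator_apply]
    rw [this, integral_indicator_one (hη.measurableSet_nonempty measurableSet_Ico),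
      hη.measureReal_nonempty hρ measurableSet_Ico, cellProb]
  have key : ∀ n (h : ℕ → ℝ) (C : ℝ), ExpBound C h →
      ∫ ω, h ((∑ i ∈ Finset.range n, B i) ω) ∂P = bernoulliMean n (cellProb ρ b) h := by
    intro n
    induction n with
    | zero => intro h C _; simp [bernoulliMean]
    | succ n ih =>
      intro h C hh
      set Z : Ω → ℕ := ∑ i ∈ Finset.range n, B i with hZ
      have hZm : Measurable Z := by
        rw [hZ]
        convert Finset.measurable_fun_sum (Finset.range n) fun i _ => hBm i using 1
        ext ω
        simp
      have hZn : ∀ ω, Z ω ≤ n := fun ω => by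
        rw [hZ, Finset.sum_apply]
        calc _ ≤ ∑ i ∈ Finset.range n, 1 := Finset.sum_le_sum fun i _ => by
              simp only [hB]; split_ifs <;> simp
          _ = n := by simp
      have hind : IndepFun Z (B n) P := hBi.indepFun_sum_range_succ hBm n
      have hint : ∀ (f : ℕ → ℝ) (C : ℝ), ExpBound C f → Integrable (fun ω => f (Z ω)) P :=
        fun f C hf => Integrable.of_bound
          (Measurable.of_discrete.comp hZm).aestronglyMeasurable (C * 2 ^ n)
          (Eventually.of_forall fun ω => abs_le_of_expBound hf (hZn ω))
      have hB1 : ∀ ω, ‖(B n ω : ℝ)‖ ≤ 1 := fun ω => by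
        simp only [hB]; split_ifs <;> simp
      have hBint : Integrable (fun ω => (B n ω : ℝ)) P := Integrable.of_bound
        (Measurable.of_discrete.comp (hBm n)).aestronglyMeasurable 1 (Eventually.of_forall hB1)
      have hsplit : ∀ ω, h ((∑ i ∈ Finset.range (n + 1), B i) ω) =
          h (Z ω) - h (Z ω) * B n ω + h (Z ω + 1) * B n ω := by
        intro ω
        rw [Finset.sum_range_succ, Pi.add_apply, ← hZ]
        simp only [hB]
        split_ifs <;> simp
      have hmul : ∀ (f : ℕ → ℝ), ∫ ω, f (Z ω) * (B n ω : ℝ) ∂P =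
          (∫ ω, f (Z ω) ∂P) * cellProb ρ b n := by
        intro f
        rw [← hBreal n]
        exact (hind.comp (φ := f) (ψ := fun k : ℕ => (k : ℝ)) Measurable.of_discrete
          Measurable.of_discrete).integral_fun_mul_eq_mul_integral
          (Measurable.of_discrete.comp hZm).aestronglyMeasurable
          (Measurable.of_discrete.comp (hBm n)).aestronglyMeasurable
      have hi1 := hint h C hh
      have hi2 : Integrable (fun ω => h (Z ω) * (B n ω : ℝ)) P :=
        hi1.mul_bdd (c := 1) hBint.aestronglyMeasurable (Eventually.of_forall hB1)
      have hi3 : Integrable (fun ω => h (Z ω + 1) * (B n ω : ℝ)) P :=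
        (hint (fun k => h (k + 1)) _ hh.shift).mul_bdd (c := 1) hBint.aestronglyMeasurable
          (Eventually.of_forall hB1)
      simp_rw [hsplit]
      have e1 := integral_add (hi1.sub hi2) hi3
      simp only [Pi.sub_apply] at e1
      rw [e1, integral_sub hi1 hi2, hmul h, hmul fun k => h (k + 1), ih h C hh,
        ih (fun k => h (k + 1)) _ hh.shift, bernoulliMean_succ_last]
      ring
  rw [← key (M + 1) h C hh]
  refine integral_congr_ae (Eventually.of_forall fun ω => ?_)
  simp [occupied, hB, Finset.sum_apply]

end PoissonProcess

section Freezing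

variable {Ω : Type*} [MeasurableSpace Ω] {P : Measure Ω} [IsProbabilityMeasure P]

/-- A discrete random variable independent of `c` may be frozen when integrating over `c`. -/
lemma integral_freeze {𝓧 L : Type*} [MeasurableSpace 𝓧] [MeasurableSpace L] [Countable L]
    [MeasurableSingletonClass L] {c : Ω → 𝓧} {l : Ω → L} (hc : Measurable c) (hl : Measurable l)
    (hind : IndepFun c l P) {Φ : L → 𝓧 → ℝ} (hΦ : ∀ v, Measurable (Φ v)) {B : ℝ}
    (hB : ∀ v x, |Φ v x| ≤ B) :
    Measurable (fun ω => Φ (l ω) (c ω)) ∧ Measurable (fun ω => ∫ ω', Φ (l ω) (c ω') ∂P) ∧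
    ∫ ω, Φ (l ω) (c ω) ∂P = ∫ ω, ∫ ω', Φ (l ω) (c ω') ∂P ∂P := by
  have hm : Measurable fun p : L × 𝓧 => Φ p.1 p.2 := measurable_from_prod_countable_right hΦ
  refine ⟨hm.comp (hl.prodMk hc), (measurable_of_countable
    (fun v : L => ∫ ω', Φ v (c ω') ∂P)).comp hl, ?_⟩
  have hmap := (indepFun_iff_map_prod_eq_prod_map_map hl.aemeasurable hc.aemeasurable).1 hind.symm
  have := Measure.isProbabilityMeasure_map (μ := P) hc.aemeasurable
  have := Measure.isProbabilityMeasure_map (μ := P) hl.aemeasurable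
  have hint : Integrable (fun p : L × 𝓧 => Φ p.1 p.2) ((P.map l).prod (P.map c)) :=
    Integrable.of_bound hm.aestronglyMeasurable B (Eventually.of_forall fun p => hB _ _)
  calc ∫ ω, Φ (l ω) (c ω) ∂P = ∫ p, Φ p.1 p.2 ∂(P.map fun ω => (l ω, c ω)) :=
        (integral_map (hl.prodMk hc).aemeasurable hm.aestronglyMeasurable).symm
    _ = ∫ v, ∫ x, Φ v x ∂(P.map c) ∂(P.map l) := by rw [hmap, integral_prod _ hint]
    _ = ∫ ω, ∫ x, Φ (l ω) x ∂(P.map c) ∂P :=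
        integral_map hl.aemeasurable (measurable_of_countable _).aestronglyMeasurable
    _ = ∫ ω, ∫ ω', Φ (l ω) (c ω') ∂P ∂P := by
        congr 1; ext ω; exact integral_map hc.aemeasurable (hΦ _).aestronglyMeasurable

end Freezing

section RandomGrid

/-- The grid `a 0, …, a M`, continued by the constant `2`. -/
def capGrid (M : ℕ) (a : ℕ → ℝ) (i : ℕ) : ℝ := if i ≤ M then a i else 2

/-- The probability that a Poisson sample on `[0, 1]` has a point in the `i`-th of the cells
`[a 0, a 1), …, [a (M - 1), a M), [a M, 1]`. -/
def gridProb (ρ : ℝ) (M : ℕ) (a : ℕ → ℝ) (i : ℕ) : ℝ :=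
  if i < M then 1 - Real.exp (-(ρ * (a (i + 1) - a i))) else 1 - Real.exp (-(ρ * (1 - a M)))

/-- A nondecreasing sequence in `[0, 1]` started at `0`. -/
structure IsUnitGrid (a : ℕ → ℝ) : Prop where
  mono : Monotone a
  zero : a 0 = 0
  le_one : ∀ i, a i ≤ 1

lemma IsUnitGrid.nonneg {a : ℕ → ℝ} (ha : IsUnitGrid a) (i : ℕ) : 0 ≤ a i :=
  ha.zero ▸ ha.mono (Nat.zero_le i)

lemma IsUnitGrid.monotone_capGrid {a : ℕ → ℝ} (ha : IsUnitGrid a) (M : ℕ) :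
    Monotone (capGrid M a) := by
  intro i j hij
  unfold capGrid
  split_ifs with h1 h2
  · exact ha.mono hij
  · linarith [ha.le_one i]
  · omega
  · rfl

lemma image_capGrid (M : ℕ) (a : ℕ → ℝ) : capGrid M a '' Iic M = a '' Iic M :=
  image_congr fun _ hi => if_pos hi

lemma IsUnitGrid.cellProb_capGrid {a : ℕ → ℝ} (ha : IsUnitGrid a) (ρ : ℝ) {M i : ℕ}
    (hi : i < M + 1) : cellProb ρ (capGrid M a) i = gridProb ρ M a i := by
  unfold cellProb gridProb
  by_cases h : i < M
  · have h0 := ha.nonneg i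
    have h1 := ha.le_one (i + 1)
    have : Ico (a i) (a (i + 1)) ∩ Icc 0 1 = Ico (a i) (a (i + 1)) :=
      inter_eq_left.2 fun u hu => ⟨h0.trans hu.1, hu.2.le.trans h1⟩
    simp only [capGrid, if_pos h, show i ≤ M by omega, show i + 1 ≤ M by omega,
      if_true, this, Real.volume_real_Ico_of_le (ha.mono (Nat.le_succ i))]
  · obtain rfl : i = M := by omega
    have h0 := ha.nonneg i
    have : Ico (a i) 2 ∩ Icc 0 1 = Icc (a i) 1 := by
      ext u
      simp only [mem_inter_iff, mem_Ico, mem_Icc]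
      constructor
      · rintro ⟨⟨h1, _⟩, _, h2⟩; exact ⟨h1, h2⟩
      · rintro ⟨h1, h2⟩; exact ⟨⟨h1, by linarith⟩, by linarith, h2⟩
    simp only [capGrid, le_refl, if_true, h, if_false, show ¬ i + 1 ≤ i by omega, this,
      Real.volume_real_Icc_of_le (ha.le_one i)]

lemma IsUnitGrid.gridProb_mem {a : ℕ → ℝ} (ha : IsUnitGrid a) {ρ : ℝ} (hρ : 0 ≤ ρ) (M i : ℕ) :
    0 ≤ gridProb ρ M a i ∧ gridProb ρ M a i ≤ 1 := by
  unfold gridProb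
  split_ifs
  · exact exp_neg_mul_mem hρ (sub_nonneg.2 (ha.mono (Nat.le_succ i)))
  · exact exp_neg_mul_mem hρ (sub_nonneg.2 (ha.le_one M))

/-- Rounding down to a multiple of `2 ^ (-k)`. -/
def dyadicFloor (k : ℕ) (x : ℝ) : ℝ := ⌊x * 2 ^ k⌋ / 2 ^ k

lemma dyadicFloor_le (k : ℕ) (x : ℝ) : dyadicFloor k x ≤ x := by
  rw [dyadicFloor, div_le_iff₀ (by positivity)]
  exact Int.floor_le _

lemma lt_dyadicFloor_add (k : ℕ) (x : ℝ) : x < dyadicFloor k x + (1 / 2) ^ k := by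
  have h := Int.lt_floor_add_one (x * 2 ^ k)
  have h2 : (0 : ℝ) < 2 ^ k := by positivity
  rw [dyadicFloor, one_div, inv_pow, ← one_div, ← add_div, lt_div_iff₀ h2]
  exact h

lemma monotone_dyadicFloor (k : ℕ) : Monotone (dyadicFloor k) := fun x y hxy => by
  unfold dyadicFloor
  gcongr

lemma tendsto_dyadicFloor (x : ℝ) : Tendsto (fun k => dyadicFloor k x) atTop (𝓝 x) := by
  have h1 : Tendsto (fun k : ℕ => x - (1 / 2 : ℝ) ^ k) atTop (𝓝 (x - 0)) :=
    tendsto_const_nhds.sub (tendsto_pow_atTop_nhds_zero_of_lt_one (by norm_num) (by norm_num))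
  rw [sub_zero] at h1
  exact tendsto_of_tendsto_of_tendsto_of_le_of_le h1 tendsto_const_nhds
    (fun k => by linarith [lt_dyadicFloor_add k x]) (fun k => dyadicFloor_le k x)

lemma IsUnitGrid.dyadicFloor {a : ℕ → ℝ} (ha : IsUnitGrid a) (k : ℕ) :
    IsUnitGrid fun i => dyadicFloor k (a i) where
  mono := (monotone_dyadicFloor k).comp ha.mono
  zero := by simp [ha.zero, PoissonizedComposition.dyadicFloor]
  le_one i := (dyadicFloor_le k _).trans (ha.le_one i)

/-- The grid of the multiples of `2 ^ (-k)` given by the integers `l`, continued by `2`. -/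
def intGrid (k M : ℕ) (l : Fin (M + 1) → ℤ) (i : ℕ) : ℝ :=
  if h : i < M + 1 then (l ⟨i, h⟩ : ℝ) / 2 ^ k else 2

lemma intGrid_floor (k M : ℕ) (a : ℕ → ℝ) :
    intGrid k M (fun j => ⌊a j * 2 ^ k⌋) = capGrid M fun i => dyadicFloor k (a i) := by
  ext i
  simp only [intGrid, capGrid, dyadicFloor, Nat.lt_succ_iff]
  split_ifs <;> rfl

lemma occupied_congr {b b' : ℕ → ℝ} {M : ℕ} {η : Set ℝ}
    (h : ∀ u ∈ η, ∀ i ≤ M + 1, (b i ≤ u ↔ b' i ≤ u)) : occupied b M η = occupied b' M η := by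
  classical
  refine Finset.sum_congr rfl fun i hi => ?_
  have hi' : i < M + 1 := Finset.mem_range.1 hi
  have : η ∩ Ico (b i) (b (i + 1)) = η ∩ Ico (b' i) (b' (i + 1)) := by
    ext u
    simp only [mem_inter_iff, mem_Ico, ← not_le]
    exact and_congr_right fun hu => by rw [h u hu i (by omega), h u hu (i + 1) (by omega)]
  rw [this]

lemma eventually_occupied_dyadicFloor {a : ℕ → ℝ} {M : ℕ} {η : Set ℝ} (hη : η.Finite)
    (hd : ∀ u ∈ η, ∀ i ≤ M, u ≠ a i) :
    ∀ᶠ k in atTop, occupied (capGrid M fun i => dyadicFloor k (a i)) M η =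
      occupied (capGrid M a) M η := by
  have : ∀ᶠ k in atTop, ∀ u ∈ η, ∀ i ∈ Iic M, (dyadicFloor k (a i) ≤ u ↔ a i ≤ u) := by
    refine (eventually_all_finite hη).2 fun u hu => (eventually_all_finite (finite_Iic M)).2
      fun i hi => ?_
    rcases lt_or_gt_of_ne (hd u hu i hi) with h | h
    · filter_upwards [(tendsto_dyadicFloor (a i)).eventually (lt_mem_nhds h)] with k hk
      exact iff_of_false (not_le.2 hk) (not_le.2 h)
    · exact Eventually.of_forall fun k => iff_of_true ((dyadicFloor_le k _).trans h.le) h.le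
  filter_upwards [this] with k hk
  refine occupied_congr fun u hu i _ => ?_
  unfold capGrid
  split_ifs with h
  · exact hk u hu i h
  · rfl

variable {Ω : Type*} [MeasurableSpace Ω] {P : Measure Ω} [IsProbabilityMeasure P]
  {η : Ω → Set ℝ} {ρ : ℝ} {a : Ω → ℕ → ℝ}

lemma measurable_floor_grid (ha : Measurable a) (k M : ℕ) :
    Measurable fun ω (j : Fin (M + 1)) => ⌊a ω j * 2 ^ k⌋ :=
  measurable_pi_lambda _ fun j =>
    (((measurable_pi_apply (j : ℕ)).comp ha).mul_const _).floor

lemma indepFun_floor_grid {P : Measure Ω} (hind : IndepFun (counts η) a P) (k M : ℕ) :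
    IndepFun (counts η) (fun ω (j : Fin (M + 1)) => ⌊a ω j * 2 ^ k⌋) P :=
  hind.comp (φ := id) (ψ := fun (x : ℕ → ℝ) (j : Fin (M + 1)) => ⌊x j * 2 ^ k⌋) measurable_id
    (measurable_floor_grid measurable_id k M)

lemma IsPoissonProcess.integral_occupied_capGrid (hη : IsPoissonProcess η ρ P) (hρ : 0 ≤ ρ)
    (ham : Measurable a) (hind : IndepFun (counts η) a P) (hag : ∀ᵐ ω ∂P, IsUnitGrid (a ω))
    (M : ℕ) (hd : ∀ᵐ ω ∂P, ∀ u ∈ η ω, ∀ i ≤ M, u ≠ a ω i) {h : ℕ → ℝ} {C : ℝ}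
    (hh : ExpBound C h) :
    AEMeasurable (fun ω => h (occupied (capGrid M (a ω)) M (η ω))) P ∧
    ∫ ω, h (occupied (capGrid M (a ω)) M (η ω)) ∂P =
      ∫ ω, bernoulliMean (M + 1) (gridProb ρ M (a ω)) h ∂P := by
  set F : ℕ → Ω → ℝ := fun k ω =>
    h (occupied (capGrid M fun i => dyadicFloor k (a ω i)) M (η ω)) with hF
  set G : ℕ → Ω → ℝ := fun k ω =>
    bernoulliMean (M + 1) (gridProb ρ M fun i => dyadicFloor k (a ω i)) h with hG
  have hbd : ∀ b (η : Set ℝ), |h (occupied b M η)| ≤ C * 2 ^ (M + 1) := fun b η =>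
    abs_le_of_expBound hh (occupied_le _ _ _)
  have hfreeze : ∀ k, Measurable (F k) ∧ ∫ ω, F k ω ∂P = ∫ ω, G k ω ∂P := by
    intro k
    obtain ⟨h1, h2, h3⟩ := integral_freeze (P := P) (c := counts η)
      (l := fun ω (j : Fin (M + 1)) => ⌊a ω j * 2 ^ k⌋)
      hη.measurable_counts (measurable_floor_grid ham k M) (indepFun_floor_grid hind k M)
      (Φ := fun l c => h (countOccupied (intGrid k M l) M c))
      (fun v => Measurable.of_discrete.comp (measurable_countOccupied _ _))
      (B := C * 2 ^ (M + 1)) (fun v x => abs_le_of_expBound hh <| by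
        calc countOccupied (intGrid k M v) M x ≤ ∑ i ∈ Finset.range (M + 1), 1 :=
              Finset.sum_le_sum fun i _ => by split_ifs <;> simp
          _ = M + 1 := by simp)
    simp only [countOccupied_counts, intGrid_floor] at h1 h2 h3
    refine ⟨h1, h3.trans (integral_congr_ae ?_)⟩
    filter_upwards [hag] with ω hω
    rw [hη.integral_occupied hρ ((hω.dyadicFloor k).monotone_capGrid M) M hh]
    exact bernoulliMean_congr (fun i hi => (hω.dyadicFloor k).cellProb_capGrid ρ hi) h
  have hFlim : ∀ᵐ ω ∂P, Tendsto (fun k => F k ω) atTop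
      (𝓝 (h (occupied (capGrid M (a ω)) M (η ω)))) := by
    filter_upwards [hη.ae_finite, hd] with ω h1 h2
    refine tendsto_const_nhds.congr' ?_
    filter_upwards [eventually_occupied_dyadicFloor h1 h2] with k hk
    simp only [hF, hk]
  have hGm : ∀ k, AEStronglyMeasurable (G k) P := by
    intro k
    refine (((continuous_bernoulliMean (M + 1) h).measurable).comp
      (measurable_pi_lambda _ fun i => ?_)).aestronglyMeasurable
    have hm : ∀ i, Measurable fun ω => dyadicFloor k (a ω i) := fun i =>
      (monotone_dyadicFloor k).measurable.comp ((measurable_pi_apply i).comp ham)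
    unfold gridProb
    have h1 := hm i
    have h2 := hm (i + 1)
    have h3 := hm M
    split_ifs <;> fun_prop
  have hGlim : ∀ᵐ ω ∂P, Tendsto (fun k => G k ω) atTop
      (𝓝 (bernoulliMean (M + 1) (gridProb ρ M (a ω)) h)) := by
    refine Eventually.of_forall fun ω => ?_
    refine ((continuous_bernoulliMean (M + 1) h).tendsto _).comp (tendsto_pi_nhds.2 fun i => ?_)
    unfold gridProb
    have h1 := tendsto_dyadicFloor (a ω i)
    have h2 := tendsto_dyadicFloor (a ω (i + 1))
    have h3 := tendsto_dyadicFloor (a ω M)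
    split_ifs
    · exact tendsto_const_nhds.sub ((Real.continuous_exp.tendsto _).comp
        ((tendsto_const_nhds.mul (h2.sub h1)).neg))
    · exact tendsto_const_nhds.sub ((Real.continuous_exp.tendsto _).comp
        ((tendsto_const_nhds.mul (tendsto_const_nhds.sub h3)).neg))
  refine ⟨aemeasurable_of_tendsto_metrizable_ae atTop (fun k => (hfreeze k).1.aemeasurable) hFlim,
    ?_⟩
  have t1 := tendsto_integral_of_dominated_convergence (fun _ => C * 2 ^ (M + 1))
    (fun k => (hfreeze k).1.aestronglyMeasurable) (integrable_const _)
    (fun k => Eventually.of_forall fun ω => hbd _ _) hFlim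
  have t2 := tendsto_integral_of_dominated_convergence (fun _ => C * 2 ^ (M + 1)) hGm
    (integrable_const _) (fun k => by
      filter_upwards [hag] with ω hω
      exact abs_bernoulliMean_le (fun i => ((hω.dyadicFloor k).gridProb_mem hρ M i).1)
        (fun i => ((hω.dyadicFloor k).gridProb_mem hρ M i).2) hh) hGlim
  exact tendsto_nhds_unique t1 (t2.congr fun k => ((hfreeze k).2).symm)

lemma volume_iUnion_ball_le {a : ℕ → ℝ} (ha : Monotone a) {r : ℝ} (hr : 0 ≤ r) (M : ℕ) :
    volume (⋃ i ∈ Iic M, Metric.ball (a i) r) ≤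
      ENNReal.ofReal ((∑ i ∈ Finset.range M, min (a (i + 1) - a i) (2 * r)) + 2 * r) := by
  induction M with
  | zero => simp
  | succ M ih =>
    have hsub : (⋃ i ∈ Iic (M + 1), Metric.ball (a i) r) ⊆
        (⋃ i ∈ Iic M, Metric.ball (a i) r) ∪
          Ico (max (a (M + 1) - r) (a M + r)) (a (M + 1) + r) := by
      intro u hu
      simp only [mem_iUnion, mem_Iic, Metric.mem_ball, Real.dist_eq, exists_prop, abs_lt] at hu
      obtain ⟨i, hi, h1, h2⟩ := hu
      by_cases hu' : ∃ j ≤ M, |u - a j| < r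
      · obtain ⟨j, hj, hj'⟩ := hu'
        left
        simp only [mem_iUnion, mem_Iic, Metric.mem_ball, Real.dist_eq, exists_prop]
        exact ⟨j, hj, hj'⟩
      · right
        push Not at hu'
        have hi' : i = M + 1 := by
          by_contra hne
          exact absurd (hu' i (by omega)) (not_le.2 (abs_lt.2 ⟨h1, h2⟩))
        subst hi'
        have h3 := hu' M le_rfl
        have h4 := ha (Nat.le_succ M)
        refine ⟨max_le (by linarith) ?_, by linarith⟩
        rcases le_abs.1 h3 with h | h
        · linarith
        · linarith
    refine (measure_mono hsub).trans ((measure_union_le _ _).trans ?_)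
    rw [Real.volume_Ico, Finset.sum_range_succ]
    have h4 : a M ≤ a (M + 1) := ha (Nat.le_succ M)
    have h5 : 0 ≤ ∑ i ∈ Finset.range M, min (a (i + 1) - a i) (2 * r) :=
      Finset.sum_nonneg fun i _ => le_min (sub_nonneg.2 (ha (Nat.le_succ i))) (by positivity)
    have h6 : a (M + 1) + r - max (a (M + 1) - r) (a M + r) = min (a (M + 1) - a M) (2 * r) := by
      rcases le_total (a (M + 1) - r) (a M + r) with h | h
      · rw [max_eq_right h, min_eq_left (by linarith)]; ring
      · rw [max_eq_left h, min_eq_right (by linarith)]; ring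
    rw [h6]
    have h7 : 0 ≤ min (a (M + 1) - a M) (2 * r) := le_min (by linarith) (by positivity)
    refine (add_le_add_left ih _).trans ?_
    rw [← ENNReal.ofReal_add (by positivity) h7]
    exact ENNReal.ofReal_le_ofReal (by linarith)

/-- A bound for the probability that a Poisson sample comes close to an independent grid. -/
lemma IsPoissonProcess.measureReal_near_le (hη : IsPoissonProcess η ρ P) (hρ : 0 ≤ ρ)
    (ham : Measurable a) (hind : IndepFun (counts η) a P) (hag : ∀ᵐ ω ∂P, IsUnitGrid (a ω))
    (M : ℕ) {ε : ℝ} (hε : 0 < ε) :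
    P.real {ω | ∃ u ∈ η ω, ∃ i ≤ M, |u - a ω i| < ε} ≤
      ρ * ∫ ω, ((∑ i ∈ Finset.range M, min (a ω (i + 1) - a ω i) (6 * ε)) + 6 * ε) ∂P := by
  obtain ⟨k, hk⟩ := exists_pow_lt_of_lt_one hε (show (1 / 2 : ℝ) < 1 by norm_num)
  set U : (Fin (M + 1) → ℤ) → Set ℝ := fun l =>
    ⋃ i ∈ Iic M, Metric.ball (intGrid k M l i) (2 * ε) with hU
  have hUm : ∀ l, MeasurableSet (U l) := fun l =>
    (isOpen_biUnion fun i _ => Metric.isOpen_ball).measurableSet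
  obtain ⟨h1, h2, h3⟩ := integral_freeze (P := P) (c := counts η)
    (l := fun ω (j : Fin (M + 1)) => ⌊a ω j * 2 ^ k⌋)
    hη.measurable_counts (measurable_floor_grid ham k M) (indepFun_floor_grid hind k M)
    (Φ := fun l c => if c ⟨U l, hUm l⟩ = 0 then 0 else 1)
    (fun v => (Measurable.of_discrete (f := fun c : ℕ∞ => if c = 0 then (0 : ℝ) else 1)).comp
      (measurable_pi_apply _))
    (B := 1) (fun v x => by split_ifs <;> simp)
  have hind1 : ∀ l, (fun ω => if counts η ω ⟨U l, hUm l⟩ = 0 then (0 : ℝ) else 1) =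
      {ω | (η ω ∩ U l).Nonempty}.indicator 1 := fun l => by
    ext ω
    simp only [counts, encard_eq_zero, nonempty_iff_ne_empty, indicator_apply]
    split_ifs <;> simp_all
  have hfr : ∀ l, ∫ ω, (if counts η ω ⟨U l, hUm l⟩ = 0 then (0 : ℝ) else 1) ∂P ≤
      ρ * volume.real (U l ∩ Icc 0 1) := fun l => by
    rw [hind1, integral_indicator_one (hη.measurableSet_nonempty (hUm l))]
    exact hη.measureReal_nonempty_le hρ (hUm l)
  have hmeas : ∀ i, Measurable fun ω => a ω i := fun i => (measurable_pi_apply i).comp ham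
  set l : Ω → Fin (M + 1) → ℤ := fun ω j => ⌊a ω j * 2 ^ k⌋ with hl
  have hgrid : ∀ ω i, i ≤ M → intGrid k M (l ω) i = dyadicFloor k (a ω i) := fun ω i hi => by
    rw [hl, intGrid_floor, capGrid, if_pos hi]
  have hset : MeasurableSet {ω | counts η ω ⟨U (l ω), hUm (l ω)⟩ ≠ 0} := by
    have : {ω | counts η ω ⟨U (l ω), hUm (l ω)⟩ ≠ 0} =
        (fun ω => if counts η ω ⟨U (l ω), hUm (l ω)⟩ = 0 then (0 : ℝ) else 1) ⁻¹' {1} := by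
      ext ω; simp
    rw [this]
    exact h1 (measurableSet_singleton 1)
  calc P.real {ω | ∃ u ∈ η ω, ∃ i ≤ M, |u - a ω i| < ε}
      ≤ P.real {ω | counts η ω ⟨U (l ω), hUm (l ω)⟩ ≠ 0} := by
        refine measureReal_mono ?_ (measure_ne_top _ _)
        rintro ω ⟨u, hu, i, hi, hui⟩
        simp only [counts, mem_ofPred_eq, ne_eq, encard_eq_zero]
        refine nonempty_iff_ne_empty.1 ⟨u, hu, ?_⟩
        simp only [hU, mem_iUnion]
        refine ⟨i, hi, ?_⟩
        rw [hgrid ω i hi, Metric.mem_ball, Real.dist_eq]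
        have h4 := dyadicFloor_le k (a ω i)
        have h5 := lt_dyadicFloor_add k (a ω i)
        rw [abs_lt] at hui ⊢
        constructor <;> linarith
    _ = ∫ ω, (if counts η ω ⟨U (l ω), hUm (l ω)⟩ = 0 then (0 : ℝ) else 1) ∂P := by
        rw [← integral_indicator_one hset]
        congr 1
        ext ω
        simp only [indicator_apply, mem_ofPred_eq, Pi.one_apply]
        split_ifs <;> simp_all
    _ ≤ ∫ ω, ρ * ((∑ i ∈ Finset.range M, min (a ω (i + 1) - a ω i) (6 * ε)) + 6 * ε) ∂P := by
        rw [h3]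
        refine integral_mono_ae ?_ ?_ ?_
        · refine Integrable.of_bound h2.aestronglyMeasurable 1 (Eventually.of_forall fun ω => ?_)
          rw [hind1, integral_indicator_one (hη.measurableSet_nonempty (hUm _)),
            Real.norm_of_nonneg measureReal_nonneg]
          exact measureReal_le_one
        · refine Integrable.of_bound (C := ρ * (M * (6 * ε) + 6 * ε)) ?_ ?_
          · refine Measurable.aestronglyMeasurable ?_
            fun_prop
          · filter_upwards [hag] with ω hω
            have hn : ∀ i, 0 ≤ min (a ω (i + 1) - a ω i) (6 * ε) := fun i =>
              le_min (sub_nonneg.2 (hω.mono (Nat.le_succ i))) (by positivity)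
            have hs := Finset.sum_nonneg fun i (_ : i ∈ Finset.range M) => hn i
            rw [Real.norm_of_nonneg (by positivity)]
            have : ∑ i ∈ Finset.range M, min (a ω (i + 1) - a ω i) (6 * ε) ≤
                ∑ i ∈ Finset.range M, 6 * ε := Finset.sum_le_sum fun i _ => min_le_right _ _
            rw [Finset.sum_const, Finset.card_range, nsmul_eq_mul] at this
            gcongr
        · filter_upwards [hag] with ω hω
          refine (hfr (l ω)).trans (mul_le_mul_of_nonneg_left ?_ hρ)
          have hsub : U (l ω) ∩ Icc 0 1 ⊆ ⋃ i ∈ Iic M, Metric.ball (a ω i) (3 * ε) := by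
            refine inter_subset_left.trans (iUnion₂_mono fun i hi u hu => ?_)
            rw [hgrid ω i hi, Metric.mem_ball, Real.dist_eq] at hu
            rw [Metric.mem_ball, Real.dist_eq]
            have h4 := dyadicFloor_le k (a ω i)
            have h5 := lt_dyadicFloor_add k (a ω i)
            rw [abs_lt] at hu ⊢
            constructor <;> linarith
          have hv := (measure_mono hsub).trans
            (volume_iUnion_ball_le hω.mono (by positivity : 0 ≤ 3 * ε) M)
          have hs := Finset.sum_nonneg fun i (_ : i ∈ Finset.range M) =>
            (le_min (sub_nonneg.2 (hω.mono (Nat.le_succ i))) (by positivity) :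
              0 ≤ min (a ω (i + 1) - a ω i) (6 * ε))
          rw [show 2 * (3 * ε) = 6 * ε by ring] at hv
          exact ENNReal.toReal_le_of_le_ofReal (by positivity) hv
    _ = _ := integral_const_mul _ _

end RandomGrid

section LevyMeasure

variable {ν : Measure ℝ}

lemma IsLevyMeasure.ae_pos (hν : IsLevyMeasure ν) : ∀ᵐ y ∂ν, 0 < y := by
  rw [ae_iff]
  convert hν.nonpos_null using 2
  ext y; simp

lemma IsLevyMeasure.integrable_min (hν : IsLevyMeasure ν) : Integrable (fun y => min 1 y) ν := by
  refine ⟨by fun_prop, ?_⟩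
  rw [hasFiniteIntegral_iff_ofReal (hν.ae_pos.mono fun y hy => le_min zero_le_one hy.le)]
  exact hν.lintegral_lt_top

lemma one_sub_exp_neg_le_min {y : ℝ} : 1 - Real.exp (-y) ≤ min 1 y :=
  le_min (by linarith [Real.exp_pos (-y)]) (by linarith [Real.add_one_le_exp (-y)])

lemma one_sub_exp_neg_mul_le {s y : ℝ} (hs : 1 ≤ s) :
    1 - Real.exp (-s * y) ≤ s * min 1 y := by
  rw [neg_mul]
  refine one_sub_exp_neg_le_min.trans ?_
  rw [mul_min_of_nonneg _ _ (by linarith), mul_one]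
  exact min_le_min_right _ hs

lemma IsLevyMeasure.integrable_one_sub_exp (hν : IsLevyMeasure ν) {s : ℝ} (hs : 0 ≤ s) :
    Integrable (fun y => 1 - Real.exp (-s * y)) ν := by
  refine (hν.integrable_min.const_mul (s + 1)).mono' (by fun_prop) ?_
  filter_upwards [hν.ae_pos] with y hy
  have h1 : Real.exp (-(s + 1) * y) ≤ Real.exp (-s * y) := Real.exp_le_exp.2 (by nlinarith)
  have h2 : Real.exp (-s * y) ≤ 1 := Real.exp_le_one_iff.2 (by nlinarith)
  rw [Real.norm_of_nonneg (by linarith)]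
  linarith [one_sub_exp_neg_mul_le (s := s + 1) (y := y) (by linarith)]

lemma IsLevyMeasure.tendsto_laplaceExponent_div (hν : IsLevyMeasure ν) :
    Tendsto (fun s : ℝ => laplaceExponent ν s / s) atTop (𝓝 0) := by
  have h : Tendsto (fun s : ℝ => ∫ y, (1 - Real.exp (-s * y)) / s ∂ν) atTop (𝓝 (∫ _, (0 : ℝ) ∂ν)) := by
    refine tendsto_integral_filter_of_dominated_convergence (fun y => min 1 y)
      (Eventually.of_forall fun s => by fun_prop) ?_ hν.integrable_min ?_
    · filter_upwards [eventually_ge_atTop 1] with s hs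
      filter_upwards [hν.ae_pos] with y hy
      have h2 : Real.exp (-s * y) ≤ 1 := Real.exp_le_one_iff.2 (by nlinarith)
      rw [Real.norm_of_nonneg (div_nonneg (by linarith) (by linarith)), div_le_iff₀ (by linarith),
        mul_comm (min 1 y)]
      exact one_sub_exp_neg_mul_le hs
    · filter_upwards [hν.ae_pos] with y hy
      refine squeeze_zero' ?_ ?_ tendsto_inv_atTop_zero
      · filter_upwards [eventually_gt_atTop 0] with s hs
        have h2 : Real.exp (-s * y) ≤ 1 := Real.exp_le_one_iff.2 (by nlinarith)
        exact div_nonneg (by linarith) hs.le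
      · filter_upwards [eventually_gt_atTop 0] with s hs
        rw [div_le_iff₀ hs, inv_mul_cancel₀ hs.ne']
        linarith [Real.exp_pos (-s * y)]
  simp only [integral_zero] at h
  refine h.congr fun s => ?_
  rw [integral_div, laplaceExponent]

end LevyMeasure

section Paths

variable {Ω : Type*} {S : ℝ≥0 → Ω → ℝ}

/-- The values of `1 - exp (-S)` along the multiples of `δ`. -/
def expGrid (S : ℝ≥0 → Ω → ℝ) (δ : ℝ≥0) (ω : Ω) (i : ℕ) : ℝ := 1 - Real.exp (-S (i * δ) ω)

/-- The dyadic time step `2 ^ (-n)`. -/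
def dyadicStep (n : ℕ) : ℝ≥0 := (2 ^ n)⁻¹

lemma expGrid_dyadic_succ (n i : ℕ) (ω : Ω) :
    expGrid S (dyadicStep (n + 1)) ω (2 * i) = expGrid S (dyadicStep n) ω i := by
  have : ((2 * i : ℕ) : ℝ≥0) * dyadicStep (n + 1) = i * dyadicStep n := by
    unfold dyadicStep
    rw [pow_succ, mul_inv]
    push_cast
    field_simp
  simp only [expGrid, this]

lemma expGrid_dyadic_mul_pow (n i : ℕ) (ω : Ω) :
    expGrid S (dyadicStep n) ω (i * 2 ^ n) = 1 - Real.exp (-S i ω) := by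
  have : ((i * 2 ^ n : ℕ) : ℝ≥0) * dyadicStep n = i := by
    unfold dyadicStep
    push_cast
    field_simp
  simp only [expGrid, this]

lemma tendsto_dyadic_right (t : ℝ≥0) :
    Tendsto (fun n : ℕ => ((⌊t * 2 ^ n⌋₊ + 1 : ℕ) : ℝ≥0) * dyadicStep n) atTop (𝓝[>] t) := by
  have h2 : ∀ n : ℕ, (0 : ℝ≥0) < 2 ^ n := fun n => by positivity
  refine tendsto_nhdsWithin_iff.2 ⟨?_, Eventually.of_forall fun n => ?_⟩
  · have hlim : Tendsto (fun n : ℕ => t + dyadicStep n) atTop (𝓝 (t + 0)) := by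
      refine tendsto_const_nhds.add ?_
      unfold dyadicStep
      simp_rw [← inv_pow]
      exact tendsto_pow_atTop_nhds_zero_of_lt_one zero_le
        (by rw [inv_lt_one₀ (by norm_num)]; norm_num)
    rw [add_zero] at hlim
    refine tendsto_of_tendsto_of_tendsto_of_le_of_le tendsto_const_nhds hlim (fun n => ?_)
      (fun n => ?_)
    · simp only [dyadicStep, ← div_eq_mul_inv]
      rw [le_div_iff₀ (h2 n)]
      exact_mod_cast (Nat.lt_floor_add_one (t * 2 ^ n)).le
    · simp only [dyadicStep, ← div_eq_mul_inv]
      rw [div_le_iff₀ (h2 n), add_mul, inv_mul_cancel₀ (h2 n).ne']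
      push_cast
      gcongr
      exact Nat.floor_le (by positivity)
  · simp only [dyadicStep, ← div_eq_mul_inv, mem_Ioi]
    rw [lt_div_iff₀ (h2 n)]
    exact_mod_cast Nat.lt_floor_add_one (t * 2 ^ n)

lemma tendsto_expGrid_dyadic_right {ω : Ω}
    (hc : ∀ t, ContinuousWithinAt (fun u => S u ω) (Ici t) t) (t : ℝ≥0) :
    Tendsto (fun n : ℕ => expGrid S (dyadicStep n) ω (⌊t * 2 ^ n⌋₊ + 1)) atTop
      (𝓝 (1 - Real.exp (-S t ω))) := by
  have h1 : Tendsto (fun u => S u ω) (𝓝[>] t) (𝓝 (S t ω)) :=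
    (hc t).tendsto.mono_left (nhdsWithin_mono _ Ioi_subset_Ici_self)
  have h2 := h1.comp (tendsto_dyadic_right t)
  have h3 : Continuous fun y : ℝ => 1 - Real.exp (-y) := by fun_prop
  exact (h3.tendsto _).comp h2

lemma exists_abs_sub_lt_of_mem_closedRange {ω : Ω} {u : ℝ} (hu : u ∈ closedRange S ω) {ε : ℝ}
    (hε : 0 < ε) : ∃ t, |u - (1 - Real.exp (-S t ω))| < ε := by
  obtain ⟨_, ⟨t, rfl⟩, ht⟩ := Metric.mem_closure_iff.1 hu ε hε
  exact ⟨t, by rwa [Real.dist_eq] at ht⟩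

end Paths

section Subordinator

variable {Ω : Type*} [MeasurableSpace Ω] {P : Measure Ω} {ν : Measure ℝ} {S : ℝ≥0 → Ω → ℝ}

lemma measurable_expGrid (hS : ∀ t, Measurable (S t)) (δ : ℝ≥0) : Measurable (expGrid S δ) :=
  measurable_pi_lambda _ fun i => by
    have := hS (i * δ)
    unfold expGrid
    fun_prop

lemma IndepOfProcess.indepFun_expGrid {η : Ω → Set ℝ} (h : IndepOfProcess η S P) (δ : ℝ≥0) :
    IndepFun (counts η) (expGrid S δ) P := by
  refine IndepFun.comp (φ := id)
    (ψ := fun (x : ℝ≥0 → ℝ) (i : ℕ) => 1 - Real.exp (-x (i * δ))) h measurable_id ?_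
  exact measurable_pi_lambda _ fun i => by fun_prop

lemma monotone_one_sub_exp_neg : Monotone fun y : ℝ => 1 - Real.exp (-y) := fun x y h => by
  have := Real.exp_le_exp.2 (neg_le_neg h)
  simp only
  linarith

lemma IsDriftlessSubordinator.ae_isUnitGrid (hS : IsDriftlessSubordinator S ν P) (δ : ℝ≥0) :
    ∀ᵐ ω ∂P, IsUnitGrid (expGrid S δ ω) := by
  filter_upwards [hS.zero, hS.monotone] with ω h0 hm
  refine ⟨fun i j hij => monotone_one_sub_exp_neg (hm ?_), by simp [expGrid, h0], fun i => ?_⟩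
  · gcongr
  · have := Real.exp_pos (-S (i * δ) ω)
    simp only [expGrid]
    linarith

lemma IsDriftlessSubordinator.integral_exp_increment (hS : IsDriftlessSubordinator S ν P)
    (δ : ℝ≥0) (i : ℕ) {s : ℝ} (hs : 0 ≤ s) :
    ∫ ω, Real.exp (-s * (S ((i + 1 : ℕ) * δ) ω - S (i * δ) ω)) ∂P =
      Real.exp (-(δ : ℝ) * laplaceExponent ν s) := by
  rw [← hS.laplace δ s hs]
  have h := (hS.stationaryIncrements (i * δ) δ).comp
    (u := fun y : ℝ => Real.exp (-s * y)) (by fun_prop)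
  have h2 := h.integral_eq
  simp only [Function.comp_def] at h2
  rw [← h2]
  push_cast
  simp only [add_mul, one_mul]

lemma min_le_two_mul_one_sub_exp {z : ℝ} (hz : 0 ≤ z) : min z 1 ≤ 2 * (1 - Real.exp (-z)) := by
  have h1 : Real.exp (-z) * (1 + z) ≤ 1 := by
    have := mul_le_mul_of_nonneg_left (Real.add_one_le_exp z) (Real.exp_pos (-z)).le
    rw [← Real.exp_add, neg_add_cancel, Real.exp_zero] at this
    linarith
  rcases le_total z 1 with h | h
  · rw [min_eq_left h]
    nlinarith [Real.exp_pos (-z)]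
  · rw [min_eq_right h]
    nlinarith [Real.exp_pos (-z)]

lemma expGrid_sub_le {x y : ℝ} (hx : 0 ≤ x) (hxy : x ≤ y) :
    (1 - Real.exp (-y)) - (1 - Real.exp (-x)) ≤ y - x := by
  have := (abs_le.1 (abs_exp_neg_sub_le hx hxy)).2
  linarith

lemma IsDriftlessSubordinator.integral_sum_min_le [IsProbabilityMeasure P]
    (hS : IsDriftlessSubordinator S ν P) (δ : ℝ≥0) (M : ℕ) {s : ℝ}
    (hs : 0 < s) :
    ∫ ω, ((∑ i ∈ Finset.range M, min (expGrid S δ ω (i + 1) - expGrid S δ ω i) s⁻¹) + s⁻¹) ∂P ≤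
      2 * (M * δ) * (laplaceExponent ν s / s) + s⁻¹ := by
  have hterm : ∀ i, Integrable
        (fun ω => min (expGrid S δ ω (i + 1) - expGrid S δ ω i) s⁻¹) P ∧
      ∫ ω, min (expGrid S δ ω (i + 1) - expGrid S δ ω i) s⁻¹ ∂P ≤
      2 * δ * (laplaceExponent ν s / s) := by
    intro i
    have hm : ∀ i, Measurable fun ω => expGrid S δ ω i := fun i =>
      (measurable_pi_apply i).comp (measurable_expGrid hS.measurable δ)
    have h1 := hm i
    have h2 := hm (i + 1)
    have hint : Integrable (fun ω => min (expGrid S δ ω (i + 1) - expGrid S δ ω i) s⁻¹) P := by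
      refine Integrable.of_bound (C := s⁻¹) (by fun_prop) ?_
      filter_upwards [hS.ae_isUnitGrid δ] with ω hω
      rw [Real.norm_of_nonneg (le_min (sub_nonneg.2 (hω.mono (Nat.le_succ i))) (by positivity))]
      exact min_le_right _ _
    refine ⟨hint, ?_⟩
    have hSm := hS.measurable ((i + 1 : ℕ) * δ)
    have hSm' := hS.measurable (i * δ)
    have hpos : ∀ᵐ ω ∂P, 0 ≤ S (i * δ) ω ∧ S (i * δ) ω ≤ S ((i + 1 : ℕ) * δ) ω := by
      filter_upwards [hS.zero, hS.monotone] with ω h0 hmo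
      refine ⟨h0 ▸ hmo zero_le, hmo ?_⟩
      gcongr
      omega
    have hexp : Integrable (fun ω => Real.exp (-s * (S ((i + 1 : ℕ) * δ) ω - S (i * δ) ω))) P := by
      refine Integrable.of_bound (C := 1) (by fun_prop) ?_
      filter_upwards [hpos] with ω hω
      rw [Real.norm_of_nonneg (Real.exp_pos _).le, Real.exp_le_one_iff]
      nlinarith [hω.2]
    calc ∫ ω, min (expGrid S δ ω (i + 1) - expGrid S δ ω i) s⁻¹ ∂P
        ≤ ∫ ω, 2 * s⁻¹ * (1 - Real.exp (-s * (S ((i + 1 : ℕ) * δ) ω - S (i * δ) ω))) ∂P := by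
          refine integral_mono_ae hint (((integrable_const _).sub hexp).const_mul _) ?_
          filter_upwards [hpos] with ω hω
          have h3 : expGrid S δ ω (i + 1) - expGrid S δ ω i ≤
              S ((i + 1 : ℕ) * δ) ω - S (i * δ) ω := expGrid_sub_le hω.1 hω.2
          have h4 := min_le_two_mul_one_sub_exp
            (mul_nonneg hs.le (sub_nonneg.2 hω.2))
          rw [neg_mul]
          set z := S ((i + 1 : ℕ) * δ) ω - S (i * δ) ω
          calc min (expGrid S δ ω (i + 1) - expGrid S δ ω i) s⁻¹ ≤ min z s⁻¹ :=
                min_le_min_right _ h3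
            _ = s⁻¹ * min (s * z) 1 := by
                rw [mul_min_of_nonneg _ _ (by positivity), inv_mul_cancel_left₀ hs.ne', mul_one]
            _ ≤ s⁻¹ * (2 * (1 - Real.exp (-(s * z)))) := by gcongr
            _ = 2 * s⁻¹ * (1 - Real.exp (-(s * z))) := by ring
      _ = 2 * s⁻¹ * (1 - Real.exp (-(δ : ℝ) * laplaceExponent ν s)) := by
          rw [integral_const_mul, integral_sub (integrable_const _) hexp,
            hS.integral_exp_increment δ i hs.le]
          simp
      _ ≤ 2 * s⁻¹ * (δ * laplaceExponent ν s) := by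
          have := Real.add_one_le_exp (-(δ : ℝ) * laplaceExponent ν s)
          gcongr
          linarith
      _ = 2 * δ * (laplaceExponent ν s / s) := by field_simp
  rw [integral_add (integrable_finsetSum _ fun i _ => (hterm i).1) (integrable_const _),
    integral_finsetSum _ fun i _ => (hterm i).1]
  have := Finset.sum_le_sum fun i (_ : i ∈ Finset.range M) => (hterm i).2
  simp only [Finset.sum_const, Finset.card_range, nsmul_eq_mul] at this
  simp only [integral_const, probReal_univ, smul_eq_mul, one_mul]
  linarith

/-- The event that a sample point is within `ε` of the grid `expGrid S δ` up to step `M`. -/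
def nearGrid (S : ℝ≥0 → Ω → ℝ) (η : Ω → Set ℝ) (δ : ℝ≥0) (M : ℕ) (ε : ℝ) : Set Ω :=
  {ω | ∃ u ∈ η ω, ∃ i ≤ M, |u - expGrid S δ ω i| < ε}

lemma measureReal_nearGrid_le [IsProbabilityMeasure P]
    (hS : IsDriftlessSubordinator S ν P) {η : Ω → Set ℝ} {ρ : ℝ} (hη : IsPoissonProcess η ρ P)
    (hρ : 0 ≤ ρ) (hηS : IndepOfProcess η S P) (δ : ℝ≥0) (M : ℕ) {s : ℝ} (hs : 0 < s) :
    P.real (nearGrid S η δ M (s⁻¹ / 6)) ≤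
      ρ * (2 * (M * δ) * (laplaceExponent ν s / s) + s⁻¹) := by
  refine (hη.measureReal_near_le hρ (measurable_expGrid hS.measurable δ)
    (hηS.indepFun_expGrid δ) (hS.ae_isUnitGrid δ) M (by positivity)).trans ?_
  rw [mul_div_cancel₀ _ (by norm_num : (6 : ℝ) ≠ 0)]
  exact mul_le_mul_of_nonneg_left (hS.integral_sum_min_le δ M hs) hρ

lemma tendsto_laplaceExponent_bound (hν : IsLevyMeasure ν) (ρ c : ℝ) :
    Tendsto (fun s : ℝ => ENNReal.ofReal (ρ * (c * (laplaceExponent ν s / s) + s⁻¹))) atTop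
      (𝓝 0) := by
  have h := ((hν.tendsto_laplaceExponent_div.const_mul c).add tendsto_inv_atTop_zero).const_mul ρ
  simpa using ENNReal.tendsto_ofReal h

lemma ae_notMem_closedRange_le [IsProbabilityMeasure P] (hν : IsLevyMeasure ν)
    (hS : IsDriftlessSubordinator S ν P) {η : Ω → Set ℝ} {ρ : ℝ} (hη : IsPoissonProcess η ρ P)
    (hρ : 0 ≤ ρ) (hηS : IndepOfProcess η S P) (T : ℕ) :
    ∀ᵐ ω ∂P, ∀ u ∈ η ω, u ≤ 1 - Real.exp (-S T ω) → u ∉ closedRange S ω := by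
  set G : Set Ω := {ω | Monotone (fun t => S t ω) ∧
    ∀ t, ContinuousWithinAt (fun u => S u ω) (Ici t) t} with hG
  set B : Set Ω := {ω | ∃ u ∈ η ω, u ≤ 1 - Real.exp (-S T ω) ∧ u ∈ closedRange S ω} with hB
  have hGae : ∀ᵐ ω ∂P, ω ∈ G := by
    filter_upwards [hS.monotone, hS.rightContinuous] with ω h1 h2 using ⟨h1, h2⟩
  have hbound : ∀ s : ℝ, 0 < s → P (B ∩ G) ≤
      ENNReal.ofReal (ρ * (2 * T * (laplaceExponent ν s / s) + s⁻¹)) := by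
    intro s hs
    set N : ℕ → Set Ω := fun n => nearGrid S η (dyadicStep n) (T * 2 ^ n) (s⁻¹ / 6) with hN
    have hmono : Monotone N := monotone_nat_of_le_succ fun n => by
      rintro ω ⟨u, hu, i, hi, h⟩
      refine ⟨u, hu, 2 * i, ?_, by rwa [expGrid_dyadic_succ]⟩
      calc 2 * i ≤ 2 * (T * 2 ^ n) := by omega
        _ = T * 2 ^ (n + 1) := by ring
    have hsub : B ∩ G ⊆ ⋃ n, N n := by
      rintro ω ⟨⟨u, hu, huT, huR⟩, hm, hc⟩
      have hε : 0 < s⁻¹ / 6 := by positivity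
      obtain ⟨t, ht⟩ := exists_abs_sub_lt_of_mem_closedRange huR hε
      rw [mem_iUnion]
      rcases lt_or_ge t (T : ℝ≥0) with htT | htT
      · have h1 := ((tendsto_expGrid_dyadic_right hc t).const_sub u).abs.eventually (gt_mem_nhds ht)
        have h2 := ((tendsto_dyadic_right t).mono_right nhdsWithin_le_nhds).eventually
          (gt_mem_nhds htT)
        obtain ⟨n, h3, h4⟩ := (h1.and h2).exists
        refine ⟨n, u, hu, _, ?_, h3⟩
        simp only [dyadicStep, ← div_eq_mul_inv] at h4
        rw [div_lt_iff₀ (by positivity)] at h4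
        exact_mod_cast h4.le
      · refine ⟨0, u, hu, T * 2 ^ 0, le_rfl, ?_⟩
        rw [expGrid_dyadic_mul_pow]
        have h1 : 1 - Real.exp (-S T ω) ≤ 1 - Real.exp (-S t ω) := monotone_one_sub_exp_neg (hm htT)
        rw [abs_lt] at ht ⊢
        constructor <;> linarith
    refine (measure_mono hsub).trans ?_
    rw [hmono.measure_iUnion]
    refine iSup_le fun n => ?_
    have h1 := measureReal_nearGrid_le hS hη hρ hηS (dyadicStep n) (T * 2 ^ n) hs
    have h2 : ((T * 2 ^ n : ℕ) : ℝ) * (dyadicStep n : ℝ) = T := by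
      simp only [dyadicStep]
      push_cast
      field_simp
    rw [h2] at h1
    exact (ENNReal.le_ofReal_iff_toReal_le (measure_ne_top _ _) (measureReal_nonneg.trans h1)).2 h1
  have hzero : P (B ∩ G) = 0 := le_antisymm
    (ge_of_tendsto (tendsto_laplaceExponent_bound hν ρ (2 * T))
      ((eventually_gt_atTop 0).mono hbound)) zero_le
  filter_upwards [measure_eq_zero_iff_ae_notMem.1 hzero, hGae] with ω h1 h2 u hu huT huR
  exact h1 ⟨⟨u, hu, huT, huR⟩, h2⟩

lemma ae_notMem_closedRange_gt [IsProbabilityMeasure P]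
    (hS : IsDriftlessSubordinator S ν P) {η : Ω → Set ℝ} {ρ : ℝ} (hη : IsPoissonProcess η ρ P)
    (hρ : 0 ≤ ρ) (hηS : IndepOfProcess η S P) :
    ∀ᵐ ω ∂P, ∀ u ∈ η ω, (∀ T : ℕ, 1 - Real.exp (-S T ω) < u) → u ∉ closedRange S ω := by
  set G : Set Ω := {ω | Monotone fun t => S t ω} with hG
  set B : Set Ω := {ω | ∃ u ∈ η ω, (∀ T : ℕ, 1 - Real.exp (-S T ω) < u) ∧ u ∈ closedRange S ω}
    with hB
  have hbound : ∀ s : ℝ, 0 < s → P (B ∩ G) ≤ ENNReal.ofReal (ρ * (2 * s⁻¹)) := by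
    intro s hs
    have hnear : ∀ T : ℕ, P (nearGrid S η T 1 (s⁻¹ / 6)) ≤ ENNReal.ofReal (ρ * (2 * s⁻¹)) := by
      intro T
      have h1 := hη.measureReal_near_le hρ (measurable_expGrid hS.measurable T)
        (hηS.indepFun_expGrid T) (hS.ae_isUnitGrid T) 1 (ε := s⁻¹ / 6) (by positivity)
      refine (ENNReal.le_ofReal_iff_toReal_le (measure_ne_top _ _) (by positivity)).2
        (h1.trans (mul_le_mul_of_nonneg_left ?_ hρ))
      rw [mul_div_cancel₀ _ (by norm_num : (6 : ℝ) ≠ 0)]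
      calc _ ≤ ∫ _, (2 * s⁻¹) ∂P := by
            refine integral_mono_of_nonneg ?_ (integrable_const _) ?_
            · filter_upwards [hS.ae_isUnitGrid T] with ω hω
              refine add_nonneg (Finset.sum_nonneg fun i _ => ?_) (by positivity)
              exact le_min (sub_nonneg.2 (hω.mono (Nat.le_succ i))) (by positivity)
            · refine Eventually.of_forall fun ω => ?_
              simp only [Finset.range_one, Finset.sum_singleton]
              have := min_le_right (expGrid S T ω (0 + 1) - expGrid S T ω 0) s⁻¹
              linarith
        _ = 2 * s⁻¹ := by simp
    set N : ℕ → Set Ω := fun n => {ω | ∀ T ≥ n, ω ∈ nearGrid S η T 1 (s⁻¹ / 6)} with hN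
    have hmono : Monotone N := fun n m hnm ω hω T hT => hω T (le_trans hnm hT)
    have hsub : B ∩ G ⊆ ⋃ n, N n := by
      rintro ω ⟨⟨u, hu, huT, huR⟩, hm⟩
      have hε : 0 < s⁻¹ / 6 := by positivity
      obtain ⟨t, ht⟩ := exists_abs_sub_lt_of_mem_closedRange huR hε
      refine mem_iUnion.2 ⟨⌈t⌉₊, fun T hT => ⟨u, hu, 1, le_rfl, ?_⟩⟩
      have h0 : expGrid S T ω 1 = 1 - Real.exp (-S T ω) := by simp [expGrid]
      have h1 : 1 - Real.exp (-S t ω) ≤ 1 - Real.exp (-S T ω) :=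
        monotone_one_sub_exp_neg (hm ((Nat.le_ceil t).trans (by exact_mod_cast hT)))
      have h2 := huT T
      rw [h0]
      rw [abs_lt] at ht ⊢
      constructor <;> linarith
    refine (measure_mono hsub).trans ?_
    rw [hmono.measure_iUnion]
    refine iSup_le fun n => ?_
    have hNn : N n ⊆ nearGrid S η n 1 (s⁻¹ / 6) := fun ω hω => hω n le_rfl
    exact (measure_mono hNn).trans (hnear n)
  have hlim : Tendsto (fun s : ℝ => ENNReal.ofReal (ρ * (2 * s⁻¹))) atTop (𝓝 0) := by
    have h := (tendsto_inv_atTop_zero (𝕜 := ℝ)).const_mul 2 |>.const_mul ρ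
    simpa using ENNReal.tendsto_ofReal h
  have hzero : P (B ∩ G) = 0 := le_antisymm
    (ge_of_tendsto hlim ((eventually_gt_atTop 0).mono hbound)) zero_le
  filter_upwards [measure_eq_zero_iff_ae_notMem.1 hzero, hS.monotone] with ω h1 h2 u hu huT huR
  exact h1 ⟨⟨u, hu, huT, huR⟩, h2⟩

/-- The closed range of a driftless subordinator contains no point of an independent Poisson
sample. -/
lemma ae_disjoint_closedRange [IsProbabilityMeasure P] (hν : IsLevyMeasure ν)
    (hS : IsDriftlessSubordinator S ν P) {η : Ω → Set ℝ} {ρ : ℝ} (hη : IsPoissonProcess η ρ P)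
    (hρ : 0 ≤ ρ) (hηS : IndepOfProcess η S P) : ∀ᵐ ω ∂P, Disjoint (η ω) (closedRange S ω) := by
  filter_upwards [ae_all_iff.2 fun T : ℕ => ae_notMem_closedRange_le hν hS hη hρ hηS T,
    ae_notMem_closedRange_gt hS hη hρ hηS] with ω h1 h2
  refine disjoint_left.2 fun u hu => ?_
  by_cases h : ∃ T : ℕ, u ≤ 1 - Real.exp (-S T ω)
  · obtain ⟨T, hT⟩ := h
    exact h1 T u hu hT
  · push Not at h
    exact h2 u hu h

end Subordinator

section StepMean

/-- One step of the recursion: the first cell has relative length `1 - exp (-y)`, the rest of the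
sample has rate `ρ exp (-y)`. -/
def mixMean (A A' : ℝ → ℝ) (ρ y : ℝ) : ℝ :=
  Real.exp (-(ρ * (1 - Real.exp (-y)))) * A (ρ * Real.exp (-y)) +
    (1 - Real.exp (-(ρ * (1 - Real.exp (-y))))) * A' (ρ * Real.exp (-y))

lemma abs_mixMean_le {A A' : ℝ → ℝ} {ρ y K : ℝ} (hρ : 0 ≤ ρ) (hy : 0 ≤ y)
    (hA : |A (ρ * Real.exp (-y))| ≤ K) (hA' : |A' (ρ * Real.exp (-y))| ≤ K) :
    |mixMean A A' ρ y| ≤ K := by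
  have hx : 0 ≤ 1 - Real.exp (-y) := sub_nonneg.2 (Real.exp_le_one_iff.2 (by linarith))
  have hq := exp_neg_mul_mem hρ hx
  have := abs_mix_le hq.1 hq.2 hA hA'
  rw [sub_sub_cancel] at this
  unfold mixMean
  linarith

lemma measurable_mixMean {A A' : ℝ → ℝ} (hA : Measurable A) (hA' : Measurable A') (ρ : ℝ) :
    Measurable (mixMean A A' ρ) := by
  unfold mixMean
  fun_prop

lemma tendsto_mixMean {A A' : ℕ → ℝ → ℝ} {B B' : ℝ → ℝ} {ρ y : ℝ}
    (hA : Tendsto (fun n => A n (ρ * Real.exp (-y))) atTop (𝓝 (B (ρ * Real.exp (-y)))))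
    (hA' : Tendsto (fun n => A' n (ρ * Real.exp (-y))) atTop (𝓝 (B' (ρ * Real.exp (-y))))) :
    Tendsto (fun n => mixMean (A n) (A' n) ρ y) atTop (𝓝 (mixMean B B' ρ y)) :=
  (hA.const_mul _).add (hA'.const_mul _)

lemma mul_exp_neg_mem {ρ y : ℝ} (hρ : 0 ≤ ρ) (hy : 0 ≤ y) :
    0 ≤ ρ * Real.exp (-y) ∧ ρ * Real.exp (-y) ≤ ρ :=
  ⟨by positivity, mul_le_of_le_one_right hρ (Real.exp_le_one_iff.2 (by linarith))⟩

variable {μ : Measure ℝ≥0} [IsProbabilityMeasure μ] {h : ℕ → ℝ} {C : ℝ}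

/-- The mean of `gapMean M` for independent increments of law `μ`. -/
def stepMean (μ : Measure ℝ≥0) [IsProbabilityMeasure μ] (M : ℕ) (h : ℕ → ℝ) (ρ : ℝ) : ℝ :=
  ∫ z, gapMean M z h ρ ∂(Measure.infinitePi fun _ : ℕ => μ)

lemma measurable_stepMean (μ : Measure ℝ≥0) [IsProbabilityMeasure μ] (M : ℕ) (h : ℕ → ℝ) :
    Measurable (stepMean μ M h) :=
  ((continuous_gapMean M h).measurable.stronglyMeasurable.integral_prod_right').measurable

lemma measurable_gapMean (M : ℕ) (h : ℕ → ℝ) (ρ : ℝ) : Measurable fun z => gapMean M z h ρ :=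
  ((continuous_gapMean M h).comp (by fun_prop : Continuous fun z => (ρ, z))).measurable

lemma integrable_gapMean {Q : Measure (ℕ → ℝ≥0)} [IsProbabilityMeasure Q] (M : ℕ)
    (hh : ExpBound C h) {ρ : ℝ} (hρ : 0 ≤ ρ) : Integrable (fun z => gapMean M z h ρ) Q :=
  Integrable.of_bound (measurable_gapMean M h ρ).aestronglyMeasurable (C * Real.exp ρ)
    (Eventually.of_forall fun _ => abs_gapMean_le hρ hh)

lemma abs_stepMean_le (hh : ExpBound C h) {ρ : ℝ} (hρ : 0 ≤ ρ) (M : ℕ) :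
    |stepMean μ M h ρ| ≤ C * Real.exp ρ := by
  have := norm_integral_le_of_norm_le_const (μ := Measure.infinitePi fun _ : ℕ => μ)
    (f := fun z => gapMean M z h ρ) (C := C * Real.exp ρ)
    (Eventually.of_forall fun z => abs_gapMean_le (M := M) (X := z) hρ hh)
  simpa [stepMean] using this

lemma abs_stepMean_sub_le (hh : ExpBound C h) {ρ ρ' : ℝ} (hρ : 0 ≤ ρ) (hρρ' : ρ ≤ ρ') (M : ℕ) :
    |stepMean μ M h ρ - stepMean μ M h ρ'| ≤ 3 * C * Real.exp ρ' * (ρ' - ρ) := by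
  rw [stepMean, stepMean, ← integral_sub (integrable_gapMean M hh hρ)
    (integrable_gapMean M hh (hρ.trans hρρ'))]
  have := norm_integral_le_of_norm_le_const (μ := Measure.infinitePi fun _ : ℕ => μ)
    (f := fun z => gapMean M z h ρ - gapMean M z h ρ') (C := 3 * C * Real.exp ρ' * (ρ' - ρ))
    (Eventually.of_forall fun z => abs_gapMean_sub_le (M := M) (X := z) hρ hρρ' hh)
  simpa using this

lemma map_head_tail (μ : Measure ℝ≥0) [IsProbabilityMeasure μ] :
    (Measure.infinitePi fun _ : ℕ => μ).map (fun z => (z 0, fun i => z (i + 1))) =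
      μ.prod (Measure.infinitePi fun _ : ℕ => μ) := by
  set Q := Measure.infinitePi fun _ : ℕ => μ
  have hX : iIndepFun (fun i (z : ℕ → ℝ≥0) => z i) Q :=
    iIndepFun_infinitePi (P := fun _ : ℕ => μ) (X := fun _ => id) fun _ => measurable_id
  have hm : ∀ i, Measurable fun z : ℕ → ℝ≥0 => z i := fun i => measurable_pi_apply i
  have htail : Measurable fun (z : ℕ → ℝ≥0) (i : ℕ) => z (i + 1) :=
    measurable_pi_lambda _ fun i => hm _
  have hind : IndepFun (fun z : ℕ → ℝ≥0 => z 0) (fun z i => z (i + 1)) Q := by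
    rw [IndepFun_iff_Indep]
    have h1 := indep_iSup_of_disjoint (fun i => (hm i).comap_le) hX.iIndep
      (S := {0}) (T := {0}ᶜ) disjoint_compl_right
    refine indep_of_indep_of_le_left (indep_of_indep_of_le_right h1 ?_) ?_
    · rw [← measurable_iff_comap_le]
      refine @measurable_pi_lambda _ _ _ (_) _ _ fun i => ?_
      exact measurable_iff_comap_le.2 (le_iSup₂_of_le (i + 1) (by simp) le_rfl)
    · exact le_iSup₂_of_le 0 (by simp) le_rfl
  have h2 := (indepFun_iff_map_prod_eq_prod_map_map (hm 0).aemeasurable htail.aemeasurable).1 hind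
  rw [h2]
  have hmap : ∀ i, Q.map (fun z : ℕ → ℝ≥0 => z i) = μ := fun i =>
    Measure.infinitePi_map_eval _ i
  have h3 := (hX.precomp (add_left_injective 1)).map_fun_eq_infinitePi_map fun i => hm _
  simp only [hmap] at h3
  rw [hmap 0]
  exact congrArg _ h3

lemma stepMean_succ (hh : ExpBound C h) {ρ : ℝ} (hρ : 0 ≤ ρ) (M : ℕ) :
    stepMean μ (M + 1) h ρ =
      ∫ y : ℝ≥0, mixMean (stepMean μ M h) (stepMean μ M fun k => h (k + 1)) ρ y ∂μ := by
  set F : ℝ≥0 × (ℕ → ℝ≥0) → ℝ := fun p =>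
    mixMean (gapMean M p.2 h) (gapMean M p.2 fun k => h (k + 1)) ρ p.1 with hF
  have hFc : Continuous F := by
    have key : Continuous fun p : ℝ≥0 × (ℕ → ℝ≥0) => (ρ * Real.exp (-(p.1 : ℝ)), p.2) := by
      fun_prop
    have h1 := (continuous_gapMean M h).comp key
    have h2 := (continuous_gapMean M fun k => h (k + 1)).comp key
    simp only [Function.comp_def] at h1 h2
    simp only [hF, mixMean]
    fun_prop
  have hbd : ∀ p, ‖F p‖ ≤ 2 * C * Real.exp ρ := by
    intro p
    obtain ⟨h1, h2⟩ := mul_exp_neg_mem hρ p.1.2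
    have hC := hh.nonneg
    have he := Real.exp_le_exp.2 h2
    refine abs_mixMean_le hρ p.1.2 ((abs_gapMean_le h1 hh).trans ?_)
      ((abs_gapMean_le h1 hh.shift).trans ?_)
    · have := mul_le_mul_of_nonneg_left he hC
      have := mul_nonneg hC (Real.exp_pos ρ).le
      linarith
    · gcongr
  have hmeas : Measurable fun z : ℕ → ℝ≥0 => (z 0, fun i => z (i + 1)) :=
    (measurable_pi_apply 0).prodMk (measurable_pi_lambda _ fun i => measurable_pi_apply _)
  have hint : Integrable F (μ.prod (Measure.infinitePi fun _ : ℕ => μ)) :=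
    Integrable.of_bound hFc.measurable.aestronglyMeasurable _ (Eventually.of_forall hbd)
  calc stepMean μ (M + 1) h ρ = ∫ z, F (z 0, fun i => z (i + 1)) ∂(Measure.infinitePi fun _ => μ) :=
        rfl
    _ = ∫ p, F p ∂(μ.prod (Measure.infinitePi fun _ => μ)) := by
        rw [← map_head_tail, integral_map hmeas.aemeasurable hFc.measurable.aestronglyMeasurable]
    _ = ∫ y, ∫ z, F (y, z) ∂(Measure.infinitePi fun _ => μ) ∂μ := integral_prod _ hint
    _ = _ := by
        refine integral_congr_ae (Eventually.of_forall fun y => ?_)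
        obtain ⟨h1, -⟩ := mul_exp_neg_mem hρ y.2
        simp only [hF, mixMean, stepMean]
        have e := integral_add (μ := Measure.infinitePi fun _ : ℕ => μ)
          ((integrable_gapMean M hh h1).const_mul (Real.exp (-(ρ * (1 - Real.exp (-(y : ℝ)))))))
          ((integrable_gapMean M hh.shift h1).const_mul
            (1 - Real.exp (-(ρ * (1 - Real.exp (-(y : ℝ)))))))
        rw [integral_const_mul, integral_const_mul] at e
        exact e

end StepMean

section IncrementSums

variable {Ω : Type*} {S : ℝ≥0 → Ω → ℝ}

/-- The increments of `S` along the multiples of `δ`. -/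
def increment (S : ℝ≥0 → Ω → ℝ) (δ : ℝ≥0) (ω : Ω) (i : ℕ) : ℝ≥0 :=
  (S ((i + 1 : ℕ) * δ) ω - S (i * δ) ω).toNNReal

lemma sum_increment {δ : ℝ≥0} {ω : Ω} (h0 : S 0 ω = 0) (hm : Monotone fun t => S t ω) (i : ℕ) :
    ∑ j ∈ Finset.range i, (increment S δ ω j : ℝ) = S (i * δ) ω := by
  induction i with
  | zero => simp [h0]
  | succ i ih =>
    have : S (i * δ) ω ≤ S ((i + 1 : ℕ) * δ) ω := hm (by gcongr; omega)
    rw [Finset.sum_range_succ, ih, increment, Real.coe_toNNReal _ (sub_nonneg.2 this)]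
    ring

lemma gridProb_expGrid {δ : ℝ≥0} {ω : Ω} (h0 : S 0 ω = 0) (hm : Monotone fun t => S t ω) (ρ : ℝ)
    (M : ℕ) : gridProb ρ M (expGrid S δ ω) = gapProb M (increment S δ ω) ρ := by
  ext i
  simp only [gridProb, gapProb, sum_increment h0 hm, expGrid]
  split_ifs
  · congr 4; ring
  · congr 4; ring

end IncrementSums

section Increments

variable {Ω : Type*} [MeasurableSpace Ω] {P : Measure Ω} [IsProbabilityMeasure P] {ν : Measure ℝ}
  {S : ℝ≥0 → Ω → ℝ}

/-- The law of `S δ`. -/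
def stepLaw (S : ℝ≥0 → Ω → ℝ) (P : Measure Ω) (δ : ℝ≥0) : Measure ℝ≥0 :=
  P.map fun ω => (S δ ω).toNNReal

lemma IsDriftlessSubordinator.isProbabilityMeasure_stepLaw (hS : IsDriftlessSubordinator S ν P)
    (δ : ℝ≥0) : IsProbabilityMeasure (stepLaw S P δ) :=
  Measure.isProbabilityMeasure_map (hS.measurable δ).real_toNNReal.aemeasurable

lemma IsDriftlessSubordinator.measurable_increment {P : Measure Ω} (hS : IsDriftlessSubordinator S ν P)
    (δ : ℝ≥0) : Measurable (increment S δ) :=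
  measurable_pi_lambda _ fun _ => ((hS.measurable _).sub (hS.measurable _)).real_toNNReal

lemma IsDriftlessSubordinator.map_increment {P : Measure Ω} (hS : IsDriftlessSubordinator S ν P) (δ : ℝ≥0)
    [IsProbabilityMeasure (stepLaw S P δ)] :
    P.map (increment S δ) = Measure.infinitePi fun _ => stepLaw S P δ := by
  have h1 : iIndepFun (fun i ω => S ((i + 1 : ℕ) * δ) ω - S (i * δ) ω) P :=
    hS.indepIncrements.nat (t := fun i : ℕ => (i : ℝ≥0) * δ) fun i j hij => by
      simp only
      gcongr
  have h2 := h1.comp (fun _ => Real.toNNReal) fun _ => measurable_real_toNNReal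
  have h3 := h2.map_fun_eq_infinitePi_map
    fun i => ((hS.measurable _).sub (hS.measurable _)).real_toNNReal
  have h4 : ∀ i : ℕ, P.map (Real.toNNReal ∘ fun ω => S ((i + 1 : ℕ) * δ) ω - S (i * δ) ω) =
      stepLaw S P δ := fun i => by
    have h := ((hS.stationaryIncrements (i * δ) δ).comp measurable_real_toNNReal).map_eq
    rw [show i * δ + δ = ((i + 1 : ℕ) : ℝ≥0) * δ by push_cast; ring] at h
    exact h
  refine h3.trans ?_
  congr 1
  exact funext h4

end Increments

section Typical

variable {Ω : Type*} {S : ℝ≥0 → Ω → ℝ} {η : Ω → Set ℝ} {h : ℕ → ℝ} {C : ℝ}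

/-- The properties of a typical path and a typical sample. -/
structure IsTypical (S : ℝ≥0 → Ω → ℝ) (η : Ω → Set ℝ) (ω : Ω) : Prop where
  zero : S 0 ω = 0
  mono : Monotone fun t => S t ω
  cont : ∀ t, ContinuousWithinAt (fun u => S u ω) (Ici t) t
  finite : (η ω).Finite
  subset : η ω ⊆ Icc 0 1
  disjoint : Disjoint (η ω) (closedRange S ω)

lemma range_expGrid_subset (δ : ℝ≥0) (ω : Ω) : range (expGrid S δ ω) ⊆ closedRange S ω := by
  rintro _ ⟨i, rfl⟩
  exact subset_closure ⟨_, rfl⟩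

lemma IsTypical.isUnitGrid {ω : Ω} (hω : IsTypical S η ω) (δ : ℝ≥0) :
    IsUnitGrid (expGrid S δ ω) where
  mono i j hij := monotone_one_sub_exp_neg (hω.mono (by gcongr))
  zero := by simp [expGrid, hω.zero]
  le_one i := by
    have := Real.exp_pos (-S (i * δ) ω)
    simp only [expGrid]
    linarith

lemma IsTypical.ne_expGrid {ω : Ω} (hω : IsTypical S η ω) (δ : ℝ≥0) {u : ℝ} (hu : u ∈ η ω)
    (i : ℕ) : u ≠ expGrid S δ ω i := fun h =>
  disjoint_left.1 hω.disjoint hu (range_expGrid_subset δ ω ⟨i, h.symm⟩)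

lemma IsTypical.numBlocks_eq {ω : Ω} (hω : IsTypical S η ω) (δ : ℝ≥0) (M : ℕ) :
    numBlocks (expGrid S δ ω '' Iic M) (η ω) =
      occupied (capGrid M (expGrid S δ ω)) M (η ω) := by
  have hg := hω.isUnitGrid δ
  rw [← image_capGrid, numBlocks_grid (hg.monotone_capGrid M)]
  · intro u hu
    have := hω.subset hu
    simp only [capGrid, zero_le, if_true, hg.zero, show ¬ M + 1 ≤ M by omega, if_false]
    exact ⟨this.1, by linarith [this.2]⟩
  · intro u hu i hi
    rw [capGrid, if_pos hi]
    exact hω.ne_expGrid δ hu i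

lemma IsTypical.eventually_numBlocks {ω : Ω} (hω : IsTypical S η ω) (δ : ℝ≥0) :
    ∀ᶠ M in atTop, numBlocks (expGrid S δ ω '' Iic M) (η ω) =
      numBlocks (range (expGrid S δ ω)) (η ω) := by
  refine eventually_numBlocks_eq_of_monotone hω.finite
    (fun i j hij => image_mono (Iic_subset_Iic.2 hij)) (fun k => image_subset_range _ _) ?_
    (hω.disjoint.mono_right (range_expGrid_subset δ ω))
  rintro _ ⟨i, rfl⟩
  exact subset_closure (mem_iUnion.2 ⟨i, mem_image_of_mem _ self_mem_Iic⟩)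

lemma IsTypical.eventually_compositionLength {ω : Ω} (hω : IsTypical S η ω) :
    ∀ᶠ n in atTop, numBlocks (range (expGrid S (dyadicStep n) ω)) (η ω) =
      compositionLength S η ω := by
  refine eventually_numBlocks_eq_of_monotone hω.finite (monotone_nat_of_le_succ fun n => ?_)
    (fun n => range_expGrid_subset _ ω) ?_ hω.disjoint
  · rintro _ ⟨i, rfl⟩
    exact ⟨2 * i, expGrid_dyadic_succ n i ω⟩
  · refine closure_minimal ?_ isClosed_closure
    rintro _ ⟨t, rfl⟩
    exact mem_closure_of_tendsto (tendsto_expGrid_dyadic_right hω.cont t)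
      (Eventually.of_forall fun n => mem_iUnion.2 ⟨n, mem_range_self _⟩)

lemma IsTypical.abs_le {ω : Ω} (hω : IsTypical S η ω) (hh : ExpBound C h) (R : Set ℝ) :
    ‖h (numBlocks R (η ω))‖ ≤ C * 2 ^ (η ω).ncard :=
  abs_le_of_expBound hh (numBlocks_le_ncard R hω.finite)

end Typical

section Limits

variable {Ω : Type*} [MeasurableSpace Ω] {P : Measure Ω} [IsProbabilityMeasure P] {ν : Measure ℝ}
  {S : ℝ≥0 → Ω → ℝ} {η : Ω → Set ℝ} {ρ : ℝ} {h : ℕ → ℝ} {C : ℝ}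

lemma ae_isTypical (hν : IsLevyMeasure ν) (hS : IsDriftlessSubordinator S ν P)
    (hη : IsPoissonProcess η ρ P) (hρ : 0 ≤ ρ) (hηS : IndepOfProcess η S P) :
    ∀ᵐ ω ∂P, IsTypical S η ω := by
  filter_upwards [hS.zero, hS.monotone, hS.rightContinuous, hη.ae_finite, hη.ae_mem_Icc hρ,
    ae_disjoint_closedRange hν hS hη hρ hηS] with ω h1 h2 h3 h4 h5 h6
    using ⟨h1, h2, h3, h4, h5, h6⟩

variable (hν : IsLevyMeasure ν) (hS : IsDriftlessSubordinator S ν P)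
  (hη : IsPoissonProcess η ρ P) (hρ : 0 ≤ ρ) (hηS : IndepOfProcess η S P)

lemma expBound_natCast : ExpBound 1 fun k : ℕ => (k : ℝ) := fun k => by
  rw [Nat.abs_cast, one_mul]
  exact_mod_cast Nat.lt_two_pow_self.le

include hν hS hη hρ hηS

lemma aemeasurable_numBlocks_grid (δ : ℝ≥0) (M : ℕ) :
    AEMeasurable (fun ω => numBlocks (expGrid S δ ω '' Iic M) (η ω)) P := by
  have hT := ae_isTypical hν hS hη hρ hηS
  have h1 := (hη.integral_occupied_capGrid hρ (measurable_expGrid hS.measurable δ)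
    (hηS.indepFun_expGrid δ) (hS.ae_isUnitGrid δ) M
    (hT.mono fun ω hω u hu i _ => hω.ne_expGrid δ hu i) expBound_natCast).1
  have h2 := Nat.measurable_floor.comp_aemeasurable h1
  refine h2.congr ?_
  filter_upwards [hT] with ω hω
  simp [hω.numBlocks_eq δ M]

lemma integral_numBlocks_grid (δ : ℝ≥0) [IsProbabilityMeasure (stepLaw S P δ)] (M : ℕ)
    (hh : ExpBound C h) :
    ∫ ω, h (numBlocks (expGrid S δ ω '' Iic M) (η ω)) ∂P = stepMean (stepLaw S P δ) M h ρ := by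
  have hT := ae_isTypical hν hS hη hρ hηS
  have h1 := (hη.integral_occupied_capGrid hρ (measurable_expGrid hS.measurable δ)
    (hηS.indepFun_expGrid δ) (hS.ae_isUnitGrid δ) M
    (hT.mono fun ω hω u hu i _ => hω.ne_expGrid δ hu i) hh).2
  rw [stepMean, ← hS.map_increment δ,
    integral_map (hS.measurable_increment δ).aemeasurable
      (measurable_gapMean M h ρ).aestronglyMeasurable]
  calc _ = ∫ ω, h (occupied (capGrid M (expGrid S δ ω)) M (η ω)) ∂P := by
        refine integral_congr_ae ?_
        filter_upwards [hT] with ω hω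
        rw [hω.numBlocks_eq δ M]
    _ = _ := by
        rw [h1]
        refine integral_congr_ae ?_
        filter_upwards [hT] with ω hω
        rw [gridProb_expGrid hω.zero hω.mono, gapMean_eq_bernoulliMean]

lemma aemeasurable_numBlocks_range (δ : ℝ≥0) :
    AEMeasurable (fun ω => numBlocks (range (expGrid S δ ω)) (η ω)) P := by
  refine aemeasurable_of_tendsto_metrizable_ae atTop
    (fun M => aemeasurable_numBlocks_grid hν hS hη hρ hηS δ M) ?_
  filter_upwards [ae_isTypical hν hS hη hρ hηS] with ω hω
  refine tendsto_const_nhds.congr' ?_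
  filter_upwards [hω.eventually_numBlocks δ] with M hM using hM.symm

lemma aemeasurable_compositionLength : AEMeasurable (compositionLength S η) P := by
  refine aemeasurable_of_tendsto_metrizable_ae atTop
    (fun n => aemeasurable_numBlocks_range hν hS hη hρ hηS (dyadicStep n)) ?_
  filter_upwards [ae_isTypical hν hS hη hρ hηS] with ω hω
  refine tendsto_const_nhds.congr' ?_
  filter_upwards [hω.eventually_compositionLength] with M hM using hM.symm

lemma integrable_compositionLength (hh : ExpBound C h) :
    Integrable (fun ω => h (compositionLength S η ω)) P := by
  refine (hη.integrable_two_pow.const_mul C).mono'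
    (Measurable.of_discrete.comp_aemeasurable
      (aemeasurable_compositionLength hν hS hη hρ hηS)).aestronglyMeasurable ?_
  filter_upwards [ae_isTypical hν hS hη hρ hηS] with ω hω using hω.abs_le hh _

lemma tendsto_stepMean (δ : ℝ≥0) [IsProbabilityMeasure (stepLaw S P δ)] (hh : ExpBound C h) :
    Tendsto (fun M => stepMean (stepLaw S P δ) M h ρ) atTop
      (𝓝 (∫ ω, h (numBlocks (range (expGrid S δ ω)) (η ω)) ∂P)) := by
  have hT := ae_isTypical hν hS hη hρ hηS
  refine (tendsto_integral_of_dominated_convergence (fun ω => C * 2 ^ (η ω).ncard)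
    (fun M => (Measurable.of_discrete.comp_aemeasurable
      (aemeasurable_numBlocks_grid hν hS hη hρ hηS δ M)).aestronglyMeasurable)
    (hη.integrable_two_pow.const_mul C) (fun M => hT.mono fun ω hω => hω.abs_le hh _) ?_).congr
    fun M => integral_numBlocks_grid hν hS hη hρ hηS δ M hh
  filter_upwards [hT] with ω hω
  refine tendsto_const_nhds.congr' ?_
  filter_upwards [hω.eventually_numBlocks δ] with M hM
  simp only [Function.comp_apply, hM]

lemma tendsto_numBlocks_range (hh : ExpBound C h) :
    Tendsto (fun n => ∫ ω, h (numBlocks (range (expGrid S (dyadicStep n) ω)) (η ω)) ∂P) atTop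
      (𝓝 (∫ ω, h (compositionLength S η ω) ∂P)) := by
  have hT := ae_isTypical hν hS hη hρ hηS
  refine tendsto_integral_of_dominated_convergence (fun ω => C * 2 ^ (η ω).ncard)
    (fun n => (Measurable.of_discrete.comp_aemeasurable
      (aemeasurable_numBlocks_range hν hS hη hρ hηS (dyadicStep n))).aestronglyMeasurable)
    (hη.integrable_two_pow.const_mul C) (fun M => hT.mono fun ω hω => hω.abs_le hh _) ?_
  filter_upwards [hT] with ω hω
  refine tendsto_const_nhds.congr' ?_
  filter_upwards [hω.eventually_compositionLength] with n hn
  simp only [hn]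

end Limits

section SmallTime

variable {Ω : Type*} [MeasurableSpace Ω] {P : Measure Ω} {ν : Measure ℝ} {S : ℝ≥0 → Ω → ℝ}

lemma abs_integral_weight_sub_le {Y : Type*} [MeasurableSpace Y] {m : Measure Y} {k w : Y → ℝ}
    (hk : Integrable k m) (hk0 : ∀ᵐ y ∂m, 0 ≤ k y) (hw : Measurable w)
    (hw01 : ∀ᵐ y ∂m, w y ∈ Icc (0 : ℝ) 1) {φ ψ : ℝ → ℝ} (hφ : Continuous φ) (hψ : Continuous ψ)
    {ε : ℝ} (hε : ∀ x ∈ Icc (0 : ℝ) 1, |φ x - ψ x| ≤ ε) :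
    |∫ y, k y * φ (w y) ∂m - ∫ y, k y * ψ (w y) ∂m| ≤ ε * ∫ y, k y ∂m := by
  have hint : ∀ φ : ℝ → ℝ, Continuous φ → Integrable (fun y => k y * φ (w y)) m := by
    intro φ hφ
    obtain ⟨B, hB⟩ := isCompact_Icc.exists_bound_of_continuousOn (s := Icc (0 : ℝ) 1)
      hφ.continuousOn
    exact hk.mul_bdd (c := B) (hφ.measurable.comp hw).aestronglyMeasurable
      (hw01.mono fun y hy => hB _ hy)
  rw [← integral_sub (hint φ hφ) (hint ψ hψ), ← integral_const_mul, ← Real.norm_eq_abs]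
  refine norm_integral_le_of_norm_le (hk.const_mul ε) ?_
  filter_upwards [hk0, hw01] with y h1 h2
  rw [← mul_sub, norm_mul, Real.norm_of_nonneg h1, mul_comm]
  exact mul_le_mul_of_nonneg_right (hε _ h2) h1

/-- The functional `φ ↦ 2 ^ n E[(1 - e^{-S}) φ (e^{-S})]` at the time `2 ^ (-n)`. -/
def smallTimeMean (S : ℝ≥0 → Ω → ℝ) (P : Measure Ω) (n : ℕ) (φ : ℝ → ℝ) : ℝ :=
  2 ^ n * ∫ ω, (1 - Real.exp (-S (dyadicStep n) ω)) * φ (Real.exp (-S (dyadicStep n) ω)) ∂P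

/-- The functional `φ ↦ ∫ (1 - e^{-y}) φ (e^{-y}) ν(dy)`. -/
def levyMean (ν : Measure ℝ) (φ : ℝ → ℝ) : ℝ :=
  ∫ y, (1 - Real.exp (-y)) * φ (Real.exp (-y)) ∂ν

lemma IsDriftlessSubordinator.ae_nonneg (hS : IsDriftlessSubordinator S ν P) (t : ℝ≥0) :
    ∀ᵐ ω ∂P, 0 ≤ S t ω := by
  filter_upwards [hS.zero, hS.monotone] with ω h0 hm
  exact h0 ▸ hm zero_le

lemma exp_neg_mem_Icc {y : ℝ} (hy : 0 ≤ y) : Real.exp (-y) ∈ Icc (0 : ℝ) 1 :=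
  ⟨(Real.exp_pos _).le, Real.exp_le_one_iff.2 (by linarith)⟩

lemma IsDriftlessSubordinator.integrable_exp [IsProbabilityMeasure P]
    (hS : IsDriftlessSubordinator S ν P) (t : ℝ≥0) {s : ℝ} (hs : 0 ≤ s) :
    Integrable (fun ω => Real.exp (-s * S t ω)) P := by
  have := hS.measurable t
  refine Integrable.of_bound (C := 1) (by fun_prop) ?_
  filter_upwards [hS.ae_nonneg t] with ω hω
  rw [Real.norm_of_nonneg (Real.exp_pos _).le, Real.exp_le_one_iff]
  nlinarith

lemma tendsto_two_pow_mul_one_sub_exp (c : ℝ) :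
    Tendsto (fun n : ℕ => (2 : ℝ) ^ n * (1 - Real.exp (-(dyadicStep n : ℝ) * c))) atTop (𝓝 c) := by
  have hd : HasDerivAt (fun t : ℝ => 1 - Real.exp (-t * c)) c 0 := by
    have h := (((hasDerivAt_id (0 : ℝ)).neg.mul_const c).exp).const_sub 1
    simpa using h
  have h1 := hd.tendsto_slope_zero
  have h2 : Tendsto (fun n : ℕ => ((dyadicStep n : ℝ≥0) : ℝ)) atTop (𝓝[≠] 0) := by
    refine tendsto_nhdsWithin_iff.2 ⟨?_, Eventually.of_forall fun n => ?_⟩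
    · have : Tendsto (fun n : ℕ => (1 / 2 : ℝ) ^ n) atTop (𝓝 0) :=
        tendsto_pow_atTop_nhds_zero_of_lt_one (by norm_num) (by norm_num)
      refine this.congr fun n => ?_
      simp [dyadicStep]
    · simp [dyadicStep]
  refine (h1.comp h2).congr fun n => ?_
  simp [dyadicStep]

lemma tendsto_smallTimeMean_pow [IsProbabilityMeasure P] (hν : IsLevyMeasure ν)
    (hS : IsDriftlessSubordinator S ν P) (k : ℕ) :
    Tendsto (fun n => smallTimeMean S P n fun w => w ^ k) atTop (𝓝 (levyMean ν fun w => w ^ k)) := by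
  have hk : (0 : ℝ) ≤ k := Nat.cast_nonneg k
  have hk1 : (0 : ℝ) ≤ (k + 1 : ℕ) := Nat.cast_nonneg _
  have hpow : ∀ y : ℝ, (1 - Real.exp (-y)) * Real.exp (-y) ^ k =
      Real.exp (-(k : ℝ) * y) - Real.exp (-((k + 1 : ℕ) : ℝ) * y) := fun y => by
    rw [sub_mul, one_mul, ← pow_succ', ← Real.exp_nat_mul, ← Real.exp_nat_mul]
    congr 2 <;> ring
  have h1 : levyMean ν (fun w => w ^ k) =
      laplaceExponent ν (k + 1 : ℕ) - laplaceExponent ν k := by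
    rw [laplaceExponent, laplaceExponent, ← integral_sub (hν.integrable_one_sub_exp hk1)
      (hν.integrable_one_sub_exp hk), levyMean]
    refine integral_congr_ae (Eventually.of_forall fun y => ?_)
    simp only [hpow]
    ring
  have h2 : ∀ n, smallTimeMean S P n (fun w => w ^ k) =
      (2 : ℝ) ^ n * (1 - Real.exp (-(dyadicStep n : ℝ) * laplaceExponent ν (k + 1 : ℕ))) -
      (2 : ℝ) ^ n * (1 - Real.exp (-(dyadicStep n : ℝ) * laplaceExponent ν k)) := fun n => by
    rw [smallTimeMean]
    simp only [hpow]
    rw [integral_sub (hS.integrable_exp _ hk) (hS.integrable_exp _ hk1), hS.laplace _ _ hk,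
      hS.laplace _ _ hk1]
    ring
  rw [h1]
  simp only [h2]
  exact (tendsto_two_pow_mul_one_sub_exp _).sub (tendsto_two_pow_mul_one_sub_exp _)

lemma IsDriftlessSubordinator.integrable_one_sub_exp [IsProbabilityMeasure P]
    (hS : IsDriftlessSubordinator S ν P) (t : ℝ≥0) :
    Integrable (fun ω => 1 - Real.exp (-S t ω)) P := by
  have := (integrable_const (1 : ℝ)).sub (hS.integrable_exp t zero_le_one)
  simpa [Pi.sub_def] using this

lemma IsLevyMeasure.integrable_one_sub_exp_neg (hν : IsLevyMeasure ν) :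
    Integrable (fun y => 1 - Real.exp (-y)) ν := by
  simpa using hν.integrable_one_sub_exp zero_le_one

lemma abs_smallTimeMean_sub_le [IsProbabilityMeasure P] (hS : IsDriftlessSubordinator S ν P) (n : ℕ)
    {φ ψ : ℝ → ℝ} (hφ : Continuous φ) (hψ : Continuous ψ) {ε : ℝ}
    (hε : ∀ x ∈ Icc (0 : ℝ) 1, |φ x - ψ x| ≤ ε) :
    |smallTimeMean S P n φ - smallTimeMean S P n ψ| ≤ ε * smallTimeMean S P n fun w => w ^ 0 := by
  have hSm := hS.measurable (dyadicStep n)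
  have hmem : ∀ᵐ ω ∂P, Real.exp (-S (dyadicStep n) ω) ∈ Icc (0 : ℝ) 1 :=
    (hS.ae_nonneg _).mono fun ω hω => exp_neg_mem_Icc hω
  have h := abs_integral_weight_sub_le (hS.integrable_one_sub_exp (dyadicStep n))
    (hmem.mono fun ω hω => sub_nonneg.2 hω.2)
    (w := fun ω => Real.exp (-S (dyadicStep n) ω)) (by fun_prop) hmem hφ hψ hε
  simp only [smallTimeMean, pow_zero, mul_one]
  rw [← mul_sub, abs_mul, abs_of_nonneg (by positivity : (0 : ℝ) ≤ 2 ^ n), mul_left_comm]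
  exact mul_le_mul_of_nonneg_left h (by positivity)

lemma abs_levyMean_sub_le (hν : IsLevyMeasure ν) {φ ψ : ℝ → ℝ} (hφ : Continuous φ)
    (hψ : Continuous ψ) {ε : ℝ} (hε : ∀ x ∈ Icc (0 : ℝ) 1, |φ x - ψ x| ≤ ε) :
    |levyMean ν φ - levyMean ν ψ| ≤ ε * levyMean ν fun w => w ^ 0 := by
  have hmem : ∀ᵐ y ∂ν, Real.exp (-y) ∈ Icc (0 : ℝ) 1 :=
    hν.ae_pos.mono fun y hy => exp_neg_mem_Icc hy.le
  have h := abs_integral_weight_sub_le hν.integrable_one_sub_exp_neg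
    (hmem.mono fun ω hω => sub_nonneg.2 hω.2) (w := fun y => Real.exp (-y)) (by fun_prop) hmem hφ
    hψ hε
  simpa only [levyMean, pow_zero, mul_one] using h

lemma tendsto_smallTimeMean_polynomial [IsProbabilityMeasure P] (hν : IsLevyMeasure ν)
    (hS : IsDriftlessSubordinator S ν P) (p : Polynomial ℝ) :
    Tendsto (fun n => smallTimeMean S P n fun w => p.eval w) atTop
      (𝓝 (levyMean ν fun w => p.eval w)) := by
  have hintS : ∀ (t : ℝ≥0) (k : ℕ), Integrable
      (fun ω => (1 - Real.exp (-S t ω)) * Real.exp (-S t ω) ^ k) P := fun t k => by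
    have := hS.measurable t
    refine (hS.integrable_one_sub_exp t).mul_bdd (c := 1) (by fun_prop) ?_
    filter_upwards [hS.ae_nonneg t] with ω hω
    rw [Real.norm_of_nonneg (by positivity)]
    exact pow_le_one₀ (exp_neg_mem_Icc hω).1 (exp_neg_mem_Icc hω).2
  have hintν : ∀ k : ℕ, Integrable (fun y => (1 - Real.exp (-y)) * Real.exp (-y) ^ k) ν := fun k => by
    refine hν.integrable_one_sub_exp_neg.mul_bdd (c := 1) (by fun_prop) ?_
    filter_upwards [hν.ae_pos] with y hy
    rw [Real.norm_of_nonneg (by positivity)]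
    exact pow_le_one₀ (exp_neg_mem_Icc hy.le).1 (exp_neg_mem_Icc hy.le).2
  have h1 : ∀ n, smallTimeMean S P n (fun w => p.eval w) =
      ∑ k ∈ Finset.range (p.natDegree + 1), p.coeff k * smallTimeMean S P n (fun w => w ^ k) := by
    intro n
    simp only [smallTimeMean, Polynomial.eval_eq_sum_range, Finset.mul_sum]
    rw [integral_finsetSum _ fun k _ => by
      simpa only [mul_left_comm] using (hintS (dyadicStep n) k).const_mul (p.coeff k),
      Finset.mul_sum]
    refine Finset.sum_congr rfl fun k _ => ?_
    simp only [mul_left_comm _ (p.coeff k), integral_const_mul]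
  have h2 : levyMean ν (fun w => p.eval w) =
      ∑ k ∈ Finset.range (p.natDegree + 1), p.coeff k * levyMean ν (fun w => w ^ k) := by
    simp only [levyMean, Polynomial.eval_eq_sum_range, Finset.mul_sum]
    rw [integral_finsetSum _ fun k _ => by
      simpa only [mul_left_comm] using (hintν k).const_mul (p.coeff k)]
    refine Finset.sum_congr rfl fun k _ => ?_
    simp only [mul_left_comm _ (p.coeff k), integral_const_mul]
  rw [h2]
  simp only [h1]
  exact tendsto_finsetSum _ fun k _ => (tendsto_smallTimeMean_pow hν hS k).const_mul _

lemma IsLevyMeasure.levyMean_one_nonneg (hν : IsLevyMeasure ν) :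
    0 ≤ levyMean ν fun w => w ^ 0 := by
  refine integral_nonneg_of_ae (hν.ae_pos.mono fun y hy => ?_)
  simpa using hy.le

/-- Uniform limits of continuous functions may be taken along with the small time limit. -/
lemma tendsto_smallTimeMean [IsProbabilityMeasure P] (hν : IsLevyMeasure ν)
    (hS : IsDriftlessSubordinator S ν P) {φ : ℕ → ℝ → ℝ} {ψ : ℝ → ℝ} (hφ : ∀ n, Continuous (φ n))
    (hψ : Continuous ψ)
    (hlim : ∀ ε > 0, ∀ᶠ n in atTop, ∀ x ∈ Icc (0 : ℝ) 1, |φ n x - ψ x| ≤ ε) :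
    Tendsto (fun n => smallTimeMean S P n (φ n)) atTop (𝓝 (levyMean ν ψ)) := by
  set I := levyMean ν fun w => w ^ 0 with hI
  have hI0 : 0 ≤ I := hν.levyMean_one_nonneg
  rw [Metric.tendsto_nhds]
  intro ε hε
  set e := ε / (3 * (I + 1) + 1) with he
  have hepos : 0 < e := by positivity
  obtain ⟨p, hp⟩ := exists_polynomial_near_of_continuousOn 0 1 ψ hψ.continuousOn e hepos
  have h1 := tendsto_smallTimeMean_polynomial hν hS p
  have h0 := tendsto_smallTimeMean_pow hν hS 0
  filter_upwards [hlim e hepos, Metric.tendsto_nhds.1 h1 e hepos,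
    h0.eventually (gt_mem_nhds (show I < I + 1 by linarith))] with n hn hn1 hn0
  rw [Real.dist_eq] at hn1 ⊢
  have a1 := abs_smallTimeMean_sub_le hS n (hφ n) hψ hn
  have a2 := abs_smallTimeMean_sub_le hS n hψ p.continuous (ε := e) fun x hx => by
    rw [abs_sub_comm]; exact (hp x hx).le
  have a3 := abs_levyMean_sub_le hν hψ p.continuous (ε := e) fun x hx => by
    rw [abs_sub_comm]; exact (hp x hx).le
  have b1 : e * smallTimeMean S P n (fun w => w ^ 0) ≤ e * (I + 1) :=
    mul_le_mul_of_nonneg_left hn0.le hepos.le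
  have b2 : e * I ≤ e * (I + 1) := by nlinarith
  have hsum : ε = e * (3 * (I + 1)) + e := by
    rw [he]; field_simp
  rw [abs_le] at a1 a2 a3
  rw [abs_lt] at hn1 ⊢
  constructor <;> linarith [a1.1, a1.2, a2.1, a2.2, a3.1, a3.2, hn1.1, hn1.2]

lemma eventually_abs_sub_le_of_lipschitz {g : ℕ → ℝ → ℝ} {g' : ℝ → ℝ} {L : ℝ≥0}
    (hg : ∀ n, LipschitzOnWith L (g n) (Icc 0 1))
    (hlim : ∀ x ∈ Icc (0 : ℝ) 1, Tendsto (fun n => g n x) atTop (𝓝 (g' x))) {ε : ℝ} (hε : 0 < ε) :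
    ∀ᶠ n in atTop, ∀ x ∈ Icc (0 : ℝ) 1, |g n x - g' x| ≤ ε := by
  have heq : Equicontinuous fun n (x : Icc (0 : ℝ) 1) => g n x :=
    (LipschitzWith.uniformEquicontinuous _ L fun n =>
      lipschitzOnWith_iff_restrict.1 (hg n)).equicontinuous
  have h1 := (heq.tendsto_uniformFun_iff_pi atTop fun x => g' x).2
    (tendsto_pi_nhds.2 fun x => hlim x x.2)
  have h2 := Metric.tendstoUniformly_iff.1 (UniformFun.tendsto_iff_tendstoUniformly.1 h1) ε hε
  filter_upwards [h2] with n hn x hx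
  have := hn ⟨x, hx⟩
  rw [dist_comm, Real.dist_eq] at this
  exact this.le

/-- If functions `g n` which vanish at `0` and are uniformly Lipschitz have mean `0` under the law
of `1 - e^{-S}` at the times `2 ^ (-n)`, then their limit has integral `0` under the Lévy
measure. -/
lemma integral_levy_eq_zero [IsProbabilityMeasure P] (hν : IsLevyMeasure ν)
    (hS : IsDriftlessSubordinator S ν P) {g : ℕ → ℝ → ℝ} {g' : ℝ → ℝ} {L : ℝ≥0}
    (hg : ∀ n, LipschitzOnWith L (g n) (Icc 0 1)) (hg' : LipschitzOnWith L g' (Icc 0 1))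
    (h0 : ∀ n, g n 0 = 0) (h0' : g' 0 = 0)
    (hlim : ∀ x ∈ Icc (0 : ℝ) 1, Tendsto (fun n => g n x) atTop (𝓝 (g' x)))
    (hmean : ∀ n, ∫ ω, g n (1 - Real.exp (-S (dyadicStep n) ω)) ∂P = 0) :
    ∫ y, g' (1 - Real.exp (-y)) ∂ν = 0 := by
  set c : ℝ → ℝ := fun w => max 0 (min 1 (1 - w)) with hc
  have hcc : Continuous c := by fun_prop
  have hcm : ∀ w, c w ∈ Icc (0 : ℝ) 1 := fun w =>
    ⟨le_max_left _ _, max_le zero_le_one (min_le_left _ _)⟩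
  have hceq : ∀ w ∈ Icc (0 : ℝ) 1, c w = 1 - w := fun w hw => by
    simp only [hc]
    rw [min_eq_right (by linarith [hw.1]), max_eq_right (by linarith [hw.2])]
  have hbd : ∀ (f : ℝ → ℝ), LipschitzOnWith L f (Icc 0 1) → f 0 = 0 →
      ∀ x ∈ Icc (0 : ℝ) 1, |f x| ≤ L * x := fun f hf hf0 x hx => by
    have := hf.dist_le_mul x hx 0 (by simp)
    rwa [Real.dist_eq, Real.dist_eq, hf0, sub_zero, sub_zero, abs_of_nonneg hx.1] at this
  have hcont : ∀ (f : ℝ → ℝ), LipschitzOnWith L f (Icc 0 1) → Continuous fun w => f (c w) :=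
    fun f hf => hf.continuousOn.comp_continuous hcc hcm
  set D : ℕ → ℝ → ℝ := fun k w => max (c w) (1 / ((k : ℝ) + 1)) with hD
  have hDc : ∀ k, Continuous (D k) := fun k => by fun_prop
  have hDpos : ∀ (k : ℕ) w, 1 / ((k : ℝ) + 1) ≤ D k w := fun k w => le_max_right _ _
  have hkpos : ∀ k : ℕ, 0 < 1 / ((k : ℝ) + 1) := fun k => by positivity
  have hDpos' : ∀ k w, 0 < D k w := fun k w => (hkpos k).trans_le (hDpos k w)
  set φ : ℕ → ℕ → ℝ → ℝ := fun k n w => g n (c w) / D k w with hφ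
  set φ' : ℕ → ℝ → ℝ := fun k w => g' (c w) / D k w with hφ'
  set ψ : ℕ → ℝ → ℝ := fun k w => 1 - c w / D k w with hψ
  have hφc : ∀ k n, Continuous (φ k n) := fun k n =>
    (hcont _ (hg n)).div (hDc k) fun w => (hDpos' k w).ne'
  have hφc' : ∀ k, Continuous (φ' k) := fun k =>
    (hcont _ hg').div (hDc k) fun w => (hDpos' k w).ne'
  have hψc : ∀ k, Continuous (ψ k) := fun k =>
    continuous_const.sub (hcc.div (hDc k) fun w => (hDpos' k w).ne')
  -- the pathwise comparison of `g` with its truncation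
  have hcmp : ∀ (f : ℝ → ℝ), LipschitzOnWith L f (Icc 0 1) → f 0 = 0 → ∀ k, ∀ w ∈ Icc (0 : ℝ) 1,
      |f (1 - w) - (1 - w) * (f (c w) / D k w)| ≤ L * ((1 - w) * ψ k w) := by
    intro f hf hf0 k w hw
    have hx : 1 - w ∈ Icc (0 : ℝ) 1 := ⟨by linarith [hw.2], by linarith [hw.1]⟩
    have hd := hDpos' k w
    have hle : c w / D k w ≤ 1 := (div_le_one hd).2 (le_max_left _ _)
    have hb := hbd f hf hf0 _ hx
    simp only [hψ]
    rw [hceq w hw] at hle ⊢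
    have e1 : f (1 - w) - (1 - w) * (f (1 - w) / D k w) = f (1 - w) * (1 - (1 - w) / D k w) := by
      ring
    rw [e1, abs_mul, abs_of_nonneg (sub_nonneg.2 hle), ← mul_assoc]
    exact mul_le_mul_of_nonneg_right hb (sub_nonneg.2 hle)
  have hbound : ∀ k, |levyMean ν (φ' k)| ≤ L * levyMean ν (ψ k) := by
    intro k
    have t1 : Tendsto (fun n => smallTimeMean S P n (φ k n)) atTop (𝓝 (levyMean ν (φ' k))) := by
      refine tendsto_smallTimeMean hν hS (hφc k) (hφc' k) fun ε hε => ?_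
      have hε' : 0 < ε * (1 / ((k : ℝ) + 1)) := mul_pos hε (hkpos k)
      filter_upwards [eventually_abs_sub_le_of_lipschitz hg hlim hε'] with n hn w _
      simp only [hφ, hφ']
      rw [← sub_div, abs_div, abs_of_pos (hDpos' k w), div_le_iff₀ (hDpos' k w)]
      exact (hn _ (hcm w)).trans (mul_le_mul_of_nonneg_left (hDpos k w) hε.le)
    have t2 : Tendsto (fun n => smallTimeMean S P n (ψ k)) atTop (𝓝 (levyMean ν (ψ k))) :=
      tendsto_smallTimeMean hν hS (fun _ => hψc k) (hψc k) fun ε hε =>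
        Eventually.of_forall fun n x _ => by simpa using hε.le
    refine le_of_tendsto_of_tendsto' t1.abs (t2.const_mul (L : ℝ)) fun n => ?_
    have hSm := hS.measurable (dyadicStep n)
    set w : Ω → ℝ := fun ω => Real.exp (-S (dyadicStep n) ω) with hw
    have hwm : Measurable w := by fun_prop
    have hmem : ∀ᵐ ω ∂P, w ω ∈ Icc (0 : ℝ) 1 :=
      (hS.ae_nonneg _).mono fun ω hω => exp_neg_mem_Icc hω
    have hint : ∀ f : ℝ → ℝ, Continuous f → Integrable (fun ω => f (w ω)) P := by
      intro f hf
      obtain ⟨B, hB⟩ := isCompact_Icc.exists_bound_of_continuousOn (s := Icc (0 : ℝ) 1)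
        hf.continuousOn
      exact Integrable.of_bound (hf.measurable.comp hwm).aestronglyMeasurable B
        (hmem.mono fun ω hω => hB _ hω)
    have hgint : Integrable (fun ω => g n (1 - w ω)) P := by
      refine (hint _ (hcont _ (hg n))).congr ?_
      filter_upwards [hmem] with ω hω
      rw [hceq _ hω]
    have hφint : Integrable (fun ω => (1 - w ω) * φ k n (w ω)) P :=
      hint (fun x => (1 - x) * φ k n x) ((continuous_const.sub continuous_id).mul (hφc k n))
    have hψint : Integrable (fun ω => (1 - w ω) * ψ k (w ω)) P :=
      hint (fun x => (1 - x) * ψ k x) ((continuous_const.sub continuous_id).mul (hψc k))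
    have key : |∫ ω, (1 - w ω) * φ k n (w ω) ∂P| ≤ L * ∫ ω, (1 - w ω) * ψ k (w ω) ∂P := by
      have e1 : ∫ ω, (g n (1 - w ω) - (1 - w ω) * φ k n (w ω)) ∂P =
          - ∫ ω, (1 - w ω) * φ k n (w ω) ∂P := by
        rw [integral_sub hgint hφint, hmean n, zero_sub]
      rw [← abs_neg, ← e1, ← integral_const_mul, ← Real.norm_eq_abs]
      refine norm_integral_le_of_norm_le (hψint.const_mul _) ?_
      filter_upwards [hmem] with ω hω
      exact hcmp _ (hg n) (h0 n) k _ hω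
    simp only [smallTimeMean]
    rw [abs_mul, abs_of_nonneg (by positivity : (0 : ℝ) ≤ 2 ^ n), mul_left_comm]
    exact mul_le_mul_of_nonneg_left key (by positivity)
  have hmemν : ∀ᵐ y ∂ν, Real.exp (-y) ∈ Icc (0 : ℝ) 1 :=
    hν.ae_pos.mono fun y hy => exp_neg_mem_Icc hy.le
  have hkey : ∀ᵐ y ∂ν, ∀ᶠ k : ℕ in atTop, D k (Real.exp (-y)) = 1 - Real.exp (-y) := by
    filter_upwards [hν.ae_pos, hmemν] with y hy hm
    have hpos : 0 < 1 - Real.exp (-y) := sub_pos.2 (Real.exp_lt_one_iff.2 (by linarith))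
    filter_upwards [tendsto_one_div_add_atTop_nhds_zero_nat.eventually (gt_mem_nhds hpos)] with k hk
    simp only [hD]
    rw [hceq _ hm, max_eq_left hk.le]
  have hratio : ∀ k, ∀ᵐ y ∂ν, 0 ≤ ψ k (Real.exp (-y)) ∧ ψ k (Real.exp (-y)) ≤ 1 := by
    intro k
    refine Eventually.of_forall fun y => ⟨?_, ?_⟩
    · exact sub_nonneg.2 ((div_le_one (hDpos' _ _)).2 (le_max_left _ _))
    · have := div_nonneg (hcm (Real.exp (-y))).1 (hDpos' k (Real.exp (-y))).le
      simp only [hψ]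
      linarith
  have lim1 : Tendsto (fun k => levyMean ν (ψ k)) atTop (𝓝 0) := by
    have := tendsto_integral_of_dominated_convergence (μ := ν)
      (F := fun k y => (1 - Real.exp (-y)) * ψ k (Real.exp (-y))) (f := fun _ => 0)
      (fun y => 1 - Real.exp (-y)) (fun k => by
        have := hψc k
        exact Continuous.aestronglyMeasurable (by fun_prop)) hν.integrable_one_sub_exp_neg
      (fun k => by
        filter_upwards [hmemν, hratio k] with y hm hr
        have h1 := sub_nonneg.2 hm.2
        rw [Real.norm_of_nonneg (mul_nonneg h1 hr.1)]
        exact mul_le_of_le_one_right h1 hr.2)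
      (by
        filter_upwards [hkey, hν.ae_pos, hmemν] with y hk hy hm
        refine tendsto_const_nhds.congr' ?_
        filter_upwards [hk] with k hk
        have hpos : 0 < 1 - Real.exp (-y) := sub_pos.2 (Real.exp_lt_one_iff.2 (by linarith))
        simp only [hψ]
        rw [hk, hceq _ hm, div_self hpos.ne', sub_self, mul_zero])
    simpa [levyMean] using this
  have lim2 : Tendsto (fun k => levyMean ν (φ' k)) atTop
      (𝓝 (∫ y, g' (1 - Real.exp (-y)) ∂ν)) := by
    refine tendsto_integral_of_dominated_convergence (fun y => L * (1 - Real.exp (-y)))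
      (fun k => by
        have := hφc' k
        exact Continuous.aestronglyMeasurable (by fun_prop))
      (hν.integrable_one_sub_exp_neg.const_mul _) (fun k => ?_) ?_
    · filter_upwards [hmemν] with y hm
      have hx : 1 - Real.exp (-y) ∈ Icc (0 : ℝ) 1 := ⟨by linarith [hm.2], by linarith [hm.1]⟩
      have hb := hbd g' hg' h0' _ hx
      simp only [hφ']
      rw [norm_mul, Real.norm_of_nonneg hx.1, Real.norm_eq_abs, abs_div, abs_of_pos (hDpos' _ _),
        mul_div_assoc', div_le_iff₀ (hDpos' _ _), hceq _ hm]
      have h2 : 1 - Real.exp (-y) ≤ D k (Real.exp (-y)) := (hceq _ hm).symm.le.trans (le_max_left _ _)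
      calc (1 - Real.exp (-y)) * |g' (1 - Real.exp (-y))|
          ≤ D k (Real.exp (-y)) * (L * (1 - Real.exp (-y))) :=
            mul_le_mul h2 hb (abs_nonneg _) (hDpos' _ _).le
        _ = _ := mul_comm _ _
    · filter_upwards [hkey, hν.ae_pos, hmemν] with y hk hy hm
      refine tendsto_const_nhds.congr' ?_
      filter_upwards [hk] with k hk
      have hpos : 0 < 1 - Real.exp (-y) := sub_pos.2 (Real.exp_lt_one_iff.2 (by linarith))
      simp only [hφ']
      rw [hk, hceq _ hm, mul_div_cancel₀ _ hpos.ne']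
  have hfin := le_of_tendsto_of_tendsto' lim2.abs (lim1.const_mul (L : ℝ)) hbound
  rw [mul_zero] at hfin
  exact abs_eq_zero.1 (le_antisymm hfin (abs_nonneg _))

end SmallTime

section Recursion

/-- The growth and Lipschitz bounds shared by all means as functions of the rate. -/
structure MeanBound (C : ℝ) (A : ℝ → ℝ) : Prop where
  nonneg : 0 ≤ C
  abs_le : ∀ r, 0 ≤ r → |A r| ≤ C * Real.exp r
  abs_sub_le : ∀ r r', 0 ≤ r → r ≤ r' → |A r - A r'| ≤ 3 * C * Real.exp r' * (r' - r)

lemma MeanBound.of_tendsto {C : ℝ} {A : ℕ → ℝ → ℝ} {B : ℝ → ℝ} (hA : ∀ n, MeanBound C (A n))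
    (hlim : ∀ r, 0 ≤ r → Tendsto (fun n => A n r) atTop (𝓝 (B r))) : MeanBound C B where
  nonneg := (hA 0).nonneg
  abs_le r hr := le_of_tendsto' (hlim r hr).abs fun n => (hA n).abs_le r hr
  abs_sub_le r r' hr hrr' := le_of_tendsto' ((hlim r hr).sub (hlim r' (hr.trans hrr'))).abs
    fun n => (hA n).abs_sub_le r r' hr hrr'

lemma meanBound_stepMean (μ : Measure ℝ≥0) [IsProbabilityMeasure μ] (M : ℕ) {h : ℕ → ℝ} {C : ℝ}
    (hh : ExpBound C h) : MeanBound C (stepMean μ M h) where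
  nonneg := hh.nonneg
  abs_le _ hr := abs_stepMean_le hh hr M
  abs_sub_le _ _ hr hrr' := abs_stepMean_sub_le hh hr hrr' M

lemma MeanBound.abs_le_of_le {C : ℝ} {A : ℝ → ℝ} (hA : MeanBound C A) {r s : ℝ} (hr : 0 ≤ r)
    (hrs : r ≤ s) : |A r| ≤ C * Real.exp s :=
  (hA.abs_le r hr).trans (mul_le_mul_of_nonneg_left (Real.exp_le_exp.2 hrs) hA.nonneg)

/-- The failure of the one-step recursion for `A`, when the first gap has length `x`. -/
def defect (A A' : ℝ → ℝ) (r x : ℝ) : ℝ :=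
  A r - (Real.exp (-(r * x)) * A (r * (1 - x)) + (1 - Real.exp (-(r * x))) * A' (r * (1 - x)))

lemma defect_zero (A A' : ℝ → ℝ) (r : ℝ) : defect A A' r 0 = 0 := by simp [defect]

lemma defect_one_sub_exp (A A' : ℝ → ℝ) (r y : ℝ) :
    defect A A' r (1 - Real.exp (-y)) = A r - mixMean A A' r y := by
  simp [defect, mixMean]

lemma abs_defect_sub_le {C r : ℝ} {A A' : ℝ → ℝ} (hA : MeanBound C A) (hA' : MeanBound (2 * C) A')
    (hr : 0 ≤ r) {x x' : ℝ} (hx : 0 ≤ x) (hxx' : x ≤ x') (hx' : x' ≤ 1) :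
    |defect A A' r x - defect A A' r x'| ≤ 9 * C * r * Real.exp r * (x' - x) := by
  have hC := hA.nonneg
  have hd : 0 ≤ x' - x := sub_nonneg.2 hxx'
  have hx0 : 0 ≤ x' := hx.trans hxx'
  have hle : r * (1 - x') ≤ r * (1 - x) := by gcongr
  have h0 : 0 ≤ r * (1 - x') := mul_nonneg hr (by linarith)
  have h1 : r * (1 - x) ≤ r := mul_le_of_le_one_right hr (by linarith)
  have he : Real.exp (r * (1 - x)) ≤ Real.exp r := Real.exp_le_exp.2 h1
  have a1 := hA.abs_le_of_le h0 (hle.trans h1)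
  have a2 := hA'.abs_le_of_le h0 (hle.trans h1)
  have b1 := hA.abs_sub_le _ _ h0 hle
  have b2 := hA'.abs_sub_le _ _ h0 hle
  have hrd : r * (1 - x) - r * (1 - x') = r * (x' - x) := by ring
  rw [hrd] at b1 b2
  have hrd0 : 0 ≤ r * (x' - x) := mul_nonneg hr hd
  have b1' : |A (r * (1 - x')) - A (r * (1 - x))| ≤ 3 * C * Real.exp r * (r * (x' - x)) :=
    b1.trans (by gcongr)
  have b2' : |A' (r * (1 - x')) - A' (r * (1 - x))| ≤ 6 * C * Real.exp r * (r * (x' - x)) := by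
    refine b2.trans ?_
    rw [show 3 * (2 * C) = 6 * C by ring]
    gcongr
  have hq := exp_neg_mul_mem hr hx
  set q := 1 - Real.exp (-(r * x)) with hqdef
  set q' := 1 - Real.exp (-(r * x')) with hqdef'
  have e1 : Real.exp (-(r * x)) = 1 - q := by rw [hqdef]; ring
  have e2 : Real.exp (-(r * x')) = 1 - q' := by rw [hqdef']; ring
  have hqq : |q - q'| ≤ r * (x' - x) := by
    have := abs_exp_neg_sub_le (mul_nonneg hr hx) (mul_le_mul_of_nonneg_left hxx' hr)
    rw [e1, e2, show 1 - q - (1 - q') = -(q - q') by ring, abs_neg] at this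
    linarith
  have hsplit : defect A A' r x - defect A A' r x' =
      ((1 - q) * (A (r * (1 - x')) - A (r * (1 - x))) +
        q * (A' (r * (1 - x')) - A' (r * (1 - x)))) +
      (q - q') * (A (r * (1 - x')) - A' (r * (1 - x'))) := by
    simp only [defect]
    rw [← hqdef, ← hqdef', e1, e2]
    ring
  have hdiff : |A (r * (1 - x')) - A' (r * (1 - x'))| ≤ 3 * C * Real.exp r := by
    rw [abs_le] at *
    constructor <;> linarith
  have hlast : |q - q'| * |A (r * (1 - x')) - A' (r * (1 - x'))| ≤
      (r * (x' - x)) * (3 * C * Real.exp r) := by gcongr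
  rw [hsplit]
  refine (abs_add_le _ _).trans ?_
  rw [abs_mul]
  refine (add_le_add (abs_mix_le hq.1 hq.2 b1' b2') hlast).trans ?_
  have hK : 0 ≤ C * Real.exp r * (r * (x' - x)) := by positivity
  nlinarith [mul_le_mul_of_nonneg_left hq.2 hK]

lemma lipschitzOnWith_defect {C r : ℝ} {A A' : ℝ → ℝ} (hA : MeanBound C A)
    (hA' : MeanBound (2 * C) A') (hr : 0 ≤ r) :
    LipschitzOnWith (9 * C * r * Real.exp r).toNNReal (defect A A' r) (Icc 0 1) := by
  have hC := hA.nonneg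
  refine LipschitzOnWith.of_dist_le_mul fun x hx y hy => ?_
  rw [Real.coe_toNNReal _ (by positivity), Real.dist_eq, Real.dist_eq]
  rcases le_total x y with h | h
  · rw [abs_sub_comm x y, abs_of_nonneg (sub_nonneg.2 h)]
    exact abs_defect_sub_le hA hA' hr hx.1 h hy.2
  · rw [abs_sub_comm (defect A A' r x), abs_of_nonneg (sub_nonneg.2 h)]
    exact abs_defect_sub_le hA hA' hr hy.1 h hx.2

variable {Ω : Type*} [MeasurableSpace Ω] {P : Measure Ω} [IsProbabilityMeasure P] {ν : Measure ℝ}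
  {S : ℝ≥0 → Ω → ℝ} {N : ℝ → Ω → Set ℝ} {h : ℕ → ℝ} {C : ℝ}

/-- The mean of `h` of the number of blocks when the grid at time step `2 ^ (-n)` separates the
sample of rate `r`. -/
def gridMean (S : ℝ≥0 → Ω → ℝ) (N : ℝ → Ω → Set ℝ) (P : Measure Ω) (n : ℕ) (h : ℕ → ℝ) (r : ℝ) :
    ℝ :=
  ∫ ω, h (numBlocks (range (expGrid S (dyadicStep n) ω)) (N r ω)) ∂P

/-- The mean of `h` of the length of the composition at rate `r`. -/
def lengthMean (S : ℝ≥0 → Ω → ℝ) (N : ℝ → Ω → Set ℝ) (P : Measure Ω) (h : ℕ → ℝ) (r : ℝ) : ℝ :=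
  ∫ ω, h (compositionLength S (N r) ω) ∂P

lemma IsDriftlessSubordinator.integral_mixMean_stepLaw {P : Measure Ω} (hS : IsDriftlessSubordinator S ν P)
    (δ : ℝ≥0) {A A' : ℝ → ℝ} (hA : Measurable A) (hA' : Measurable A') (r : ℝ) :
    ∫ y : ℝ≥0, mixMean A A' r y ∂(stepLaw S P δ) = ∫ ω, mixMean A A' r (S δ ω) ∂P := by
  refine (integral_map (f := fun y : ℝ≥0 => mixMean A A' r y)
    (hS.measurable δ).real_toNNReal.aemeasurable
    ((measurable_mixMean hA hA' r).comp measurable_coe_nnreal_real).aestronglyMeasurable).trans ?_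
  refine integral_congr_ae ?_
  filter_upwards [hS.ae_nonneg δ] with ω hω
  rw [Real.coe_toNNReal _ hω]

variable (hν : IsLevyMeasure ν) (hS : IsDriftlessSubordinator S ν P)
  (hN : ∀ ρ : ℝ, 0 ≤ ρ → IsPoissonProcess (N ρ) ρ P)
  (hNS : ∀ ρ : ℝ, 0 ≤ ρ → IndepOfProcess (N ρ) S P)

include hν hS hN hNS

lemma meanBound_gridMean (n : ℕ) (hh : ExpBound C h) : MeanBound C (gridMean S N P n h) := by
  have := hS.isProbabilityMeasure_stepLaw (dyadicStep n)
  exact MeanBound.of_tendsto (fun M => meanBound_stepMean (stepLaw S P (dyadicStep n)) M hh)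
    fun r hr => tendsto_stepMean hν hS (hN r hr) hr (hNS r hr) (dyadicStep n) hh

lemma tendsto_gridMean (hh : ExpBound C h) {r : ℝ} (hr : 0 ≤ r) :
    Tendsto (fun n => gridMean S N P n h r) atTop (𝓝 (lengthMean S N P h r)) :=
  tendsto_numBlocks_range hν hS (hN r hr) hr (hNS r hr) hh

lemma meanBound_lengthMean (hh : ExpBound C h) : MeanBound C (lengthMean S N P h) :=
  MeanBound.of_tendsto (fun n => meanBound_gridMean hν hS hN hNS n hh)
    fun _ hr => tendsto_gridMean hν hS hN hNS hh hr

/-- The one-step recursion for the grid with time step `2 ^ (-n)`. -/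
lemma integral_defect_gridMean (n : ℕ) (hh : ExpBound C h) {r : ℝ} (hr : 0 ≤ r) :
    ∫ ω, defect (gridMean S N P n h) (gridMean S N P n fun k => h (k + 1)) r
      (1 - Real.exp (-S (dyadicStep n) ω)) ∂P = 0 := by
  set δ := dyadicStep n
  have := hS.isProbabilityMeasure_stepLaw δ
  set μ := stepLaw S P δ
  have hC := hh.nonneg
  have hmeas : ∀ M, Measurable (mixMean (stepMean μ M h) (stepMean μ M fun k => h (k + 1)) r) :=
    fun M => measurable_mixMean (measurable_stepMean μ M h) (measurable_stepMean μ M _) r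
  have hF : ∀ M, AEStronglyMeasurable
      (fun ω => mixMean (stepMean μ M h) (stepMean μ M fun k => h (k + 1)) r (S δ ω)) P :=
    fun M => ((hmeas M).comp (hS.measurable δ)).aestronglyMeasurable
  have hbd : ∀ M, ∀ᵐ ω ∂P,
      ‖mixMean (stepMean μ M h) (stepMean μ M fun k => h (k + 1)) r (S δ ω)‖ ≤
        2 * C * Real.exp r := fun M => by
    filter_upwards [hS.ae_nonneg δ] with ω hω
    obtain ⟨h1, h2⟩ := mul_exp_neg_mem hr hω
    refine abs_mixMean_le hr hω (((meanBound_stepMean μ M hh).abs_le_of_le h1 h2).trans ?_)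
      ((meanBound_stepMean μ M hh.shift).abs_le_of_le h1 h2)
    have := mul_nonneg hC (Real.exp_pos r).le
    linarith
  have hlim : ∀ᵐ ω ∂P, Tendsto
      (fun M => mixMean (stepMean μ M h) (stepMean μ M fun k => h (k + 1)) r (S δ ω)) atTop
      (𝓝 (mixMean (gridMean S N P n h) (gridMean S N P n fun k => h (k + 1)) r (S δ ω))) := by
    filter_upwards [hS.ae_nonneg δ] with ω hω
    obtain ⟨h1, -⟩ := mul_exp_neg_mem hr hω
    exact tendsto_mixMean (tendsto_stepMean hν hS (hN _ h1) h1 (hNS _ h1) δ hh)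
      (tendsto_stepMean hν hS (hN _ h1) h1 (hNS _ h1) δ hh.shift)
  have t1 := tendsto_integral_of_dominated_convergence (fun _ => 2 * C * Real.exp r) hF
    (integrable_const _) hbd hlim
  have t2 := (tendsto_stepMean hν hS (hN r hr) hr (hNS r hr) δ hh).comp (tendsto_add_atTop_nat 1)
  have heq : ∀ M, stepMean μ (M + 1) h r =
      ∫ ω, mixMean (stepMean μ M h) (stepMean μ M fun k => h (k + 1)) r (S δ ω) ∂P := fun M => by
    rw [stepMean_succ hh hr M, hS.integral_mixMean_stepLaw δ (measurable_stepMean μ M h)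
      (measurable_stepMean μ M _) r]
  have hG : gridMean S N P n h r = ∫ ω, mixMean (gridMean S N P n h)
      (gridMean S N P n fun k => h (k + 1)) r (S δ ω) ∂P :=
    tendsto_nhds_unique t2 (t1.congr fun M => (heq M).symm)
  have hint : Integrable (fun ω => mixMean (gridMean S N P n h)
      (gridMean S N P n fun k => h (k + 1)) r (S δ ω)) P := by
    refine Integrable.of_bound (C := 2 * C * Real.exp r)
      (aestronglyMeasurable_of_tendsto_ae atTop hF hlim) ?_
    filter_upwards [hlim, ae_all_iff.2 hbd] with ω h1 h2
    exact le_of_tendsto' h1.norm h2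
  simp only [defect_one_sub_exp]
  rw [integral_sub (integrable_const _) hint, ← hG]
  simp

lemma integral_defect_lengthMean (hh : ExpBound C h) {r : ℝ} (hr : 0 ≤ r) :
    ∫ y, defect (lengthMean S N P h) (lengthMean S N P fun k => h (k + 1)) r
      (1 - Real.exp (-y)) ∂ν = 0 := by
  refine integral_levy_eq_zero hν hS (L := (9 * C * r * Real.exp r).toNNReal)
    (g := fun n => defect (gridMean S N P n h) (gridMean S N P n fun k => h (k + 1)) r)
    (fun n => lipschitzOnWith_defect (meanBound_gridMean hν hS hN hNS n hh)
      (meanBound_gridMean hν hS hN hNS n hh.shift) hr)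
    (lipschitzOnWith_defect (meanBound_lengthMean hν hS hN hNS hh)
      (meanBound_lengthMean hν hS hN hNS hh.shift) hr)
    (fun n => defect_zero _ _ _) (defect_zero _ _ _) (fun x hx => ?_)
    fun n => integral_defect_gridMean hν hS hN hNS n hh hr
  have hx' : 0 ≤ r * (1 - x) := mul_nonneg hr (sub_nonneg.2 hx.2)
  exact (tendsto_gridMean hν hS hN hNS hh hr).sub
    (((tendsto_gridMean hν hS hN hNS hh hx').const_mul _).add
      ((tendsto_gridMean hν hS hN hNS hh.shift hx').const_mul _))

end Recursion

section ImageMeasure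

variable {ν : Measure ℝ}

lemma measurable_one_sub_exp_neg : Measurable fun y : ℝ => 1 - Real.exp (-y) := by fun_prop

lemma IsLevyMeasure.ae_mem_expImage (hν : IsLevyMeasure ν) :
    ∀ᵐ x ∂(expImage ν), x ∈ Ioc (0 : ℝ) 1 := by
  refine (ae_map_iff (p := fun x => x ∈ Ioc (0 : ℝ) 1) measurable_one_sub_exp_neg.aemeasurable
    measurableSet_Ioc).2 ?_
  filter_upwards [hν.ae_pos] with y hy
  exact ⟨sub_pos.2 (Real.exp_lt_one_iff.2 (by linarith)), by linarith [Real.exp_pos (-y)]⟩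

lemma IsLevyMeasure.restrict_expImage (hν : IsLevyMeasure ν) :
    (expImage ν).restrict (Ioc 0 1) = expImage ν :=
  Measure.restrict_eq_self_of_ae_mem hν.ae_mem_expImage

lemma IsLevyMeasure.integrableOn_expImage (hν : IsLevyMeasure ν) {F : ℝ → ℝ} {L : ℝ}
    (hF : ContinuousOn F (Icc 0 1)) (hL : ∀ x ∈ Icc (0 : ℝ) 1, |F x| ≤ L * x) :
    IntegrableOn F (Ioc 0 1) (expImage ν) := by
  have hid : Integrable (fun x : ℝ => x) (expImage ν) :=
    (integrable_map_measure (g := fun x : ℝ => x) measurable_id.aestronglyMeasurable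
      measurable_one_sub_exp_neg.aemeasurable).2 hν.integrable_one_sub_exp_neg
  refine (hid.const_mul L).integrableOn.mono'
    ((hF.mono Ioc_subset_Icc_self).aestronglyMeasurable measurableSet_Ioc) ?_
  filter_upwards [ae_restrict_mem measurableSet_Ioc] with x hx
  exact hL x (Ioc_subset_Icc_self hx)

lemma IsLevyMeasure.setIntegral_expImage (hν : IsLevyMeasure ν) {F : ℝ → ℝ}
    (hF : ContinuousOn F (Icc 0 1)) :
    ∫ x in Ioc 0 1, F x ∂(expImage ν) = ∫ y, F (1 - Real.exp (-y)) ∂ν := by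
  have h1 : AEStronglyMeasurable F ((expImage ν).restrict (Ioc 0 1)) :=
    (hF.mono Ioc_subset_Icc_self).aestronglyMeasurable measurableSet_Ioc
  rw [hν.restrict_expImage] at h1 ⊢
  exact integral_map measurable_one_sub_exp_neg.aemeasurable h1

lemma abs_le_of_lipschitzOnWith {L : ℝ≥0} {f : ℝ → ℝ} (hf : LipschitzOnWith L f (Icc 0 1))
    (h0 : f 0 = 0) {x : ℝ} (hx : x ∈ Icc (0 : ℝ) 1) : |f x| ≤ L * x := by
  have := hf.dist_le_mul x hx 0 (by simp)
  rwa [Real.dist_eq, Real.dist_eq, h0, sub_zero, sub_zero, abs_of_nonneg hx.1] at this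

lemma MeanBound.continuousOn {C : ℝ} {A : ℝ → ℝ} (hA : MeanBound C A) :
    ContinuousOn A (Ici 0) := by
  have hcont : ∀ s : ℝ, ContinuousOn A (Icc 0 s) := fun s => by
    have hC := hA.nonneg
    refine (LipschitzOnWith.of_dist_le_mul (K := (3 * C * Real.exp s).toNNReal)
      fun x hx y hy => ?_).continuousOn
    rw [Real.coe_toNNReal _ (by positivity), Real.dist_eq, Real.dist_eq]
    rcases le_total x y with h | h
    · rw [abs_sub_comm x y, abs_of_nonneg (sub_nonneg.2 h)]
      refine (hA.abs_sub_le x y hx.1 h).trans ?_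
      have := Real.exp_le_exp.2 hy.2
      have := sub_nonneg.2 h
      gcongr
    · rw [abs_sub_comm (A x), abs_of_nonneg (sub_nonneg.2 h)]
      refine (hA.abs_sub_le y x hy.1 h).trans ?_
      have := Real.exp_le_exp.2 hx.2
      have := sub_nonneg.2 h
      gcongr
  intro x hx
  refine ((hcont (x + 1)).continuousWithinAt ⟨hx, by linarith⟩).mono_of_mem_nhdsWithin ?_
  rw [← Ici_inter_Iic]
  exact inter_mem self_mem_nhdsWithin (mem_nhdsWithin_of_mem_nhds (Iic_mem_nhds (by linarith)))

lemma MeanBound.continuousOn_comp {C : ℝ} {A : ℝ → ℝ} (hA : MeanBound C A) {r : ℝ} (hr : 0 ≤ r) :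
    ContinuousOn (fun x => A (r * (1 - x))) (Icc 0 1) :=
  hA.continuousOn.comp (by fun_prop) fun _ hx => mul_nonneg hr (sub_nonneg.2 hx.2)

lemma MeanBound.continuousOn_gap {C : ℝ} {A : ℝ → ℝ} (hA : MeanBound C A) {r : ℝ} (hr : 0 ≤ r) :
    ContinuousOn (fun x => (1 - Real.exp (-(r * x))) * A (r * (1 - x))) (Icc 0 1) :=
  ContinuousOn.mul (by fun_prop) (hA.continuousOn_comp hr)

lemma MeanBound.integrableOn_gap (hν : IsLevyMeasure ν) {C : ℝ} {A : ℝ → ℝ} (hA : MeanBound C A)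
    {r : ℝ} (hr : 0 ≤ r) :
    IntegrableOn (fun x => (1 - Real.exp (-(r * x))) * A (r * (1 - x))) (Ioc 0 1) (expImage ν) := by
  refine hν.integrableOn_expImage (L := r * (C * Real.exp r)) (hA.continuousOn_gap hr)
    fun x hx => ?_
  have h1 : r * (1 - x) ≤ r := mul_le_of_le_one_right hr (by linarith [hx.1])
  have h2 := hA.abs_le_of_le (mul_nonneg hr (sub_nonneg.2 hx.2)) h1
  have h3 := exp_neg_mul_mem hr hx.1
  rw [abs_mul, abs_of_nonneg h3.1]
  calc _ ≤ (r * x) * (C * Real.exp r) := by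
        refine mul_le_mul ?_ h2 (abs_nonneg _) (mul_nonneg hr hx.1)
        linarith [Real.add_one_le_exp (-(r * x))]
    _ = _ := by ring

variable {Ω : Type*} [MeasurableSpace Ω] {P : Measure Ω} [IsProbabilityMeasure P]
  {S : ℝ≥0 → Ω → ℝ} {N : ℝ → Ω → Set ℝ} {h : ℕ → ℝ} {C : ℝ}

lemma defect_lengthMean (hν : IsLevyMeasure ν) (hS : IsDriftlessSubordinator S ν P)
    (hN : ∀ ρ : ℝ, 0 ≤ ρ → IsPoissonProcess (N ρ) ρ P)
    (hNS : ∀ ρ : ℝ, 0 ≤ ρ → IndepOfProcess (N ρ) S P) (hh : ExpBound C h) {r : ℝ} (hr : 0 ≤ r) :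
    IntegrableOn (defect (lengthMean S N P h) (lengthMean S N P fun k => h (k + 1)) r) (Ioc 0 1)
      (expImage ν) ∧
    ∫ x in Ioc 0 1, defect (lengthMean S N P h) (lengthMean S N P fun k => h (k + 1)) r x
      ∂(expImage ν) = 0 := by
  have hL := lipschitzOnWith_defect (meanBound_lengthMean hν hS hN hNS hh)
    (meanBound_lengthMean hν hS hN hNS hh.shift) hr
  refine ⟨hν.integrableOn_expImage hL.continuousOn
    fun x hx => abs_le_of_lipschitzOnWith hL (defect_zero _ _ _) hx, ?_⟩
  rw [hν.setIntegral_expImage hL.continuousOn]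
  exact integral_defect_lengthMean hν hS hN hNS hh hr

lemma expBound_indicator (j : ℕ) : ExpBound 1 fun k => if k = j then 1 else 0 := fun k => by
  have : (1 : ℝ) ≤ 2 ^ k := one_le_pow₀ one_le_two
  simp only [one_mul]
  split_ifs
  · simpa using this
  · simp

lemma expBound_descFactorial (m : ℕ) :
    ExpBound (m.factorial : ℝ) fun k => (k.descFactorial m : ℝ) := fun k => by
  rw [Nat.abs_cast, Nat.descFactorial_eq_factorial_mul_choose]
  push_cast
  gcongr
  exact_mod_cast Nat.choose_le_two_pow k m

lemma lengthProb_eq_lengthMean (hν : IsLevyMeasure ν) (hS : IsDriftlessSubordinator S ν P)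
    (hN : ∀ ρ : ℝ, 0 ≤ ρ → IsPoissonProcess (N ρ) ρ P)
    (hNS : ∀ ρ : ℝ, 0 ≤ ρ → IndepOfProcess (N ρ) S P) (j : ℕ) {r : ℝ} (hr : 0 ≤ r) :
    lengthProb S N P j r = lengthMean S N P (fun k => if k = j then 1 else 0) r := by
  have hm := aemeasurable_compositionLength hν hS (hN r hr) hr (hNS r hr)
  have hs : NullMeasurableSet {ω | compositionLength S (N r) ω = j} P :=
    hm.nullMeasurable (measurableSet_singleton j)
  have : (fun ω => if compositionLength S (N r) ω = j then (1 : ℝ) else 0) =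
      {ω | compositionLength S (N r) ω = j}.indicator fun _ => 1 := by
    ext ω; simp [indicator_apply]
  rw [lengthMean, this, integral_indicator₀ hs, lengthProb]
  simp

end ImageMeasure

end PoissonizedComposition

end

theorem lemma6p1 {Ω : Type*} [MeasurableSpace Ω] (P : Measure Ω) [IsProbabilityMeasure P]
    (ν : Measure ℝ) (hν : PoissonizedComposition.IsLevyMeasure ν)
    (S : ℝ≥0 → Ω → ℝ) (hS : PoissonizedComposition.IsDriftlessSubordinator S ν P)
    (N : ℝ → Ω → Set ℝ)
    (hN : ∀ ρ : ℝ, 0 ≤ ρ → PoissonizedComposition.IsPoissonProcess (N ρ) ρ P)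
    (hNS : ∀ ρ : ℝ, 0 ≤ ρ → PoissonizedComposition.IndepOfProcess (N ρ) S P) :
    let K := fun ρ : ℝ => PoissonizedComposition.compositionLength S (N ρ)
    let p := PoissonizedComposition.lengthProb S N P
    let f := PoissonizedComposition.factorialMoment S N P
    let ν' := PoissonizedComposition.expImage ν
    -- the length is a random variable and all its factorial moments are finite
    (∀ ρ : ℝ, 0 ≤ ρ → AEMeasurable (K ρ) P ∧
      ∀ m : ℕ, Integrable (fun ω => ((K ρ ω).descFactorial m : ℝ)) P) ∧
    -- the recursion for the distribution, with convergent integrals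
    (∀ ρ : ℝ, 0 ≤ ρ → ∀ j : ℕ, 1 ≤ j →
      IntegrableOn (fun x => p j ρ - Real.exp (-(ρ * x)) * p j (ρ * (1 - x))) (Ioc 0 1) ν' ∧
      IntegrableOn (fun x => (1 - Real.exp (-(ρ * x))) * p (j - 1) (ρ * (1 - x))) (Ioc 0 1) ν' ∧
      ∫ x in Ioc 0 1, (p j ρ - Real.exp (-(ρ * x)) * p j (ρ * (1 - x))) ∂ν' =
        ∫ x in Ioc 0 1, (1 - Real.exp (-(ρ * x))) * p (j - 1) (ρ * (1 - x)) ∂ν') ∧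
    -- the recursion for the factorial moments, with convergent integrals
    (∀ ρ : ℝ, 0 ≤ ρ → ∀ m : ℕ, 1 ≤ m →
      IntegrableOn (fun x => f m ρ - f m (ρ * (1 - x))) (Ioc 0 1) ν' ∧
      IntegrableOn (fun x => (1 - Real.exp (-(ρ * x))) * f (m - 1) (ρ * (1 - x))) (Ioc 0 1) ν' ∧
      ∫ x in Ioc 0 1, (f m ρ - f m (ρ * (1 - x))) ∂ν' =
        m * ∫ x in Ioc 0 1, (1 - Real.exp (-(ρ * x))) * f (m - 1) (ρ * (1 - x)) ∂ν') := by
  intro K p f ν'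
  have hp : ∀ j (r : ℝ), 0 ≤ r → p j r =
      PoissonizedComposition.lengthMean S N P (fun k => if k = j then 1 else 0) r := fun j r hr =>
    PoissonizedComposition.lengthProb_eq_lengthMean hν hS hN hNS j hr
  have hρx : ∀ {ρ x : ℝ}, 0 ≤ ρ → x ∈ Ioc (0 : ℝ) 1 → 0 ≤ ρ * (1 - x) := fun hρ hx =>
    mul_nonneg hρ (sub_nonneg.2 hx.2)
  refine ⟨fun ρ hρ => ⟨PoissonizedComposition.aemeasurable_compositionLength hν hS (hN ρ hρ) hρ
    (hNS ρ hρ), fun m => PoissonizedComposition.integrable_compositionLength hν hS (hN ρ hρ) hρ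
    (hNS ρ hρ) (PoissonizedComposition.expBound_descFactorial m)⟩, ?_, ?_⟩
  · intro ρ hρ j hj
    obtain ⟨hd, hd0⟩ := PoissonizedComposition.defect_lengthMean hν hS hN hNS
      (PoissonizedComposition.expBound_indicator j) hρ
    have hg := (PoissonizedComposition.meanBound_lengthMean hν hS hN hNS
      (PoissonizedComposition.expBound_indicator (j - 1))).integrableOn_gap hν hρ
    have hshift : (fun k : ℕ => if k + 1 = j then (1 : ℝ) else 0) =
        fun k => if k = j - 1 then 1 else 0 := by
      ext k
      congr 1
      exact propext ⟨fun h => by omega, fun h => by omega⟩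
    rw [hshift] at hd hd0
    have e2 : ∀ x ∈ Ioc (0 : ℝ) 1, (1 - Real.exp (-(ρ * x))) *
        PoissonizedComposition.lengthMean S N P (fun k => if k = j - 1 then 1 else 0)
          (ρ * (1 - x)) = (1 - Real.exp (-(ρ * x))) * p (j - 1) (ρ * (1 - x)) := fun x hx => by
      rw [hp _ _ (hρx hρ hx)]
    have e1 : ∀ x ∈ Ioc (0 : ℝ) 1,
        PoissonizedComposition.defect
          (PoissonizedComposition.lengthMean S N P fun k => if k = j then 1 else 0)
          (PoissonizedComposition.lengthMean S N P fun k => if k = j - 1 then 1 else 0) ρ x +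
        (1 - Real.exp (-(ρ * x))) * p (j - 1) (ρ * (1 - x)) =
        p j ρ - Real.exp (-(ρ * x)) * p j (ρ * (1 - x)) := fun x hx => by
      rw [hp _ _ (hρx hρ hx), hp _ _ (hρx hρ hx), hp _ _ hρ, PoissonizedComposition.defect]
      ring
    have hg' := hg.congr_fun e2 measurableSet_Ioc
    refine ⟨(hd.add hg').congr_fun e1 measurableSet_Ioc, hg', ?_⟩
    rw [← setIntegral_congr_fun measurableSet_Ioc e1, integral_add hd hg', hd0, zero_add]
  · intro ρ hρ m hm
    obtain ⟨hd, hd0⟩ := PoissonizedComposition.defect_lengthMean hν hS hN hNS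
      (PoissonizedComposition.expBound_descFactorial m) hρ
    have hg := (PoissonizedComposition.meanBound_lengthMean hν hS hN hNS
      (PoissonizedComposition.expBound_descFactorial (m - 1))).integrableOn_gap hν hρ
    have hf : ∀ m r, f m r =
      PoissonizedComposition.lengthMean S N P (fun k => (k.descFactorial m : ℝ)) r :=
      fun _ _ => rfl
    have hshift : ∀ r : ℝ, 0 ≤ r →
        PoissonizedComposition.lengthMean S N P (fun k => ((k + 1).descFactorial m : ℝ)) r =
          f m r + m * f (m - 1) r := fun r hr => by
      have hi : ∀ m : ℕ, Integrable (fun ω =>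
          ((PoissonizedComposition.compositionLength S (N r) ω).descFactorial m : ℝ)) P := fun m =>
        PoissonizedComposition.integrable_compositionLength hν hS (hN r hr) hr (hNS r hr)
          (PoissonizedComposition.expBound_descFactorial m)
      rw [hf, hf, PoissonizedComposition.lengthMean, PoissonizedComposition.lengthMean,
        PoissonizedComposition.lengthMean, ← integral_const_mul,
        ← integral_add (hi m) ((hi (m - 1)).const_mul _)]
      refine integral_congr_ae (Filter.Eventually.of_forall fun ω => ?_)
      obtain ⟨m, rfl⟩ := Nat.exists_eq_add_of_le' hm
      simp only [Nat.add_sub_cancel]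
      generalize PoissonizedComposition.compositionLength S (N r) ω = k
      rw [Nat.succ_descFactorial_succ]
      have h1 : (k.descFactorial (m + 1) : ℝ) = (k - m) * k.descFactorial m := by
        rw [Nat.descFactorial_succ]
        rcases le_or_gt m k with h | h
        · push_cast [Nat.cast_sub h]; ring
        · simp [Nat.descFactorial_of_lt h]
      rw [h1]
      push_cast
      ring
    have e1 : ∀ x ∈ Ioc (0 : ℝ) 1,
        PoissonizedComposition.defect
          (PoissonizedComposition.lengthMean S N P fun k => (k.descFactorial m : ℝ))
          (PoissonizedComposition.lengthMean S N P fun k => ((k + 1).descFactorial m : ℝ)) ρ x +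
        m * ((1 - Real.exp (-(ρ * x))) * f (m - 1) (ρ * (1 - x))) =
        f m ρ - f m (ρ * (1 - x)) := fun x hx => by
      rw [PoissonizedComposition.defect, hshift _ (hρx hρ hx), ← hf, ← hf]
      ring
    have hgm := hg.const_mul (m : ℝ)
    refine ⟨(hd.add hgm).congr_fun e1 measurableSet_Ioc, hg, ?_⟩
    rw [← setIntegral_congr_fun measurableSet_Ioc e1]
    refine (integral_add hd hgm).trans ?_
    rw [hd0, zero_add, integral_const_mul]
    rfl
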